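/- Let $\mathbb{C}_+=\{s\in\mathbb{C}:\operatorname{Re}s>0\}$ and let $H^2(\mathbb{C}_+)$ be the Hardy space of holomorphic functions $f$ on $\mathbb{C}_+$ with $\sup_{x>0}\int_{\mathbb{R}}|f(x+iy)|^2\,dy<\infty$, a Hilbert space with inner product $\langle f,g\rangle=\int_{\mathbb{R}}f(iy)\overline{g(iy)}\,dy$ of boundary functions. For $t\ge 0$ let $M(t)$ be the operator $(M(t)g)(s)=e^{-ts}g(s)$ on $H^2(\mathbb{C}_+)$; a subspace is called backward shift-invariant if it is invariant under all adjoints $M(t)^*$, $t\ge 0$. Fix $\delta>0$. For $g\in H^2(\mathbb{C}_+)$ let $$N(g)=\bigvee\{g(s)e^{-\lambda s}:0\le\lambda\le\delta\}$$ be the smallest closed subspace of $H^2(\mathbb{C}_+)$ containing all the functions $g(s)e^{-\lambda s}$ with $0\le\lambda\le\delta$, and for an inner function $\theta$ on $\mathbb{C}_+$ let $K_\theta=H^2(\mathbb{C}_+)\ominus\theta H^2(\mathbb{C}_+)$ be the model space of $\theta$. Then for every integer $n\ge 0$ the subspace $N\big(1/(1+s)^{n+1}\big)$ is backward shift-invariant,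 the function $\big(\frac{1-s}{1+s}\big)^{n+1}e^{-\delta s}$ is inner, and $$N\Big(\frac{1}{(1+s)^{n+1}}\Big)=K_{\left(\frac{1-s}{1+s}\right)^{n+1}e^{-\delta s}}.$$ -/

import Mathlib

namespace HardyRHP

open MeasureTheory Filter Set Topology
open scoped NNReal ENNReal ComplexConjugate

/-- The open right half-plane `ℂ₊`. -/
def rightHalfPlane : Set ℂ := {s | 0 < s.re}

/-- The restriction `y ↦ f (x + i y)` of `f` to the vertical line with abscissa `x`. -/
def slice (f : ℂ → ℂ) (x : ℝ) : ℝ → ℂ := fun y => f (x + y * Complex.I)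

/-- `f` is holomorphic on `ℂ₊` and `sup_{x > 0} ∫ |f (x + i y)|² dy < ∞`. Values of `f` outside `ℂ₊`
are irrelevant. -/
structure IsHardy (f : ℂ → ℂ) : Prop where
  differentiableOn : DifferentiableOn ℂ f rightHalfPlane
  bounded : ∃ C : ℝ≥0, ∀ x : ℝ, 0 < x → eLpNorm (slice f x) 2 volume ≤ C

/-- `f` is a Hardy class function on `ℂ₊` with boundary function `y ↦ f (i y)` equal to `F`, the
limit in `L²(ℝ)` of the slices `f (x + i ·)` as `x → 0+`. -/
structure HasBoundary (f : ℂ → ℂ) (F : Lp ℂ 2 (volume : Measure ℝ)) : Prop extends IsHardy f where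
  tendsto : Tendsto (fun x : ℝ => eLpNorm (fun y => slice f x y - F y) 2 volume) (𝓝[>] 0) (𝓝 0)

theorem isOpen_rightHalfPlane : IsOpen rightHalfPlane :=
  isOpen_lt continuous_const Complex.continuous_re

theorem continuous_slice {f : ℂ → ℂ} (hf : DifferentiableOn ℂ f rightHalfPlane) {x : ℝ}
    (hx : 0 < x) : Continuous (slice f x) := by
  refine hf.continuousOn.comp_continuous (by fun_prop) fun y => ?_
  simpa [rightHalfPlane] using hx

theorem eLpNorm_two_sq (g : ℝ → ℂ) : eLpNorm g 2 volume ^ 2 = ∫⁻ y, ‖g y‖ₑ ^ 2 := by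
  have := eLpNorm_nnreal_pow_eq_lintegral (μ := volume) (f := g) (p := 2) (by norm_num)
  simpa using this

theorem eLpNorm_slice_translate (f : ℂ → ℂ) (x η : ℝ) (hc : Continuous (slice f x)) :
    eLpNorm (fun y => slice f x (η + y)) 2 volume = eLpNorm (slice f x) 2 volume :=
  eLpNorm_comp_measurePreserving (g := slice f x) hc.aestronglyMeasurable
    (measurePreserving_add_left volume η)

/-- The slice norms of a Hardy function decrease as one moves away from the boundary. -/
theorem IsHardy.eLpNorm_slice_le {f : ℂ → ℂ} (hf : IsHardy f) {a x : ℝ} (ha : 0 < a)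
    (hax : a ≤ x) : eLpNorm (slice f x) 2 volume ≤ eLpNorm (slice f a) 2 volume := by
  have hx : 0 < x := ha.trans_le hax
  have hcx := continuous_slice hf.differentiableOn hx
  obtain ⟨C, hC⟩ := hf.bounded
  -- truncated pairing with the slice at `x`
  have key : ∀ R : ℝ, 0 ≤ R → ∫⁻ y in Icc (-R) R, ‖slice f x y‖ₑ ^ 2 ≤
      eLpNorm (slice f a) 2 volume ^ 2 := by
    intro R hR
    set g : ℝ → ℂ := (Icc (-R) R).indicator (slice f x) with hg
    have hgm : AEStronglyMeasurable g volume :=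
      hcx.aestronglyMeasurable.indicator measurableSet_Icc
    have hg2 : eLpNorm g 2 volume ^ 2 = ∫⁻ y in Icc (-R) R, ‖slice f x y‖ₑ ^ 2 := by
      rw [eLpNorm_two_sq, ← lintegral_indicator measurableSet_Icc]
      congr 1; ext y
      by_cases hy : y ∈ Icc (-R) R <;> simp [hg, hy]
    have hgle : eLpNorm g 2 volume ≤ C := (eLpNorm_indicator_le _).trans (hC x hx)
    have hgtop : eLpNorm g 2 volume ≠ ∞ := (hgle.trans_lt ENNReal.coe_lt_top).ne
    have hsa : ∀ b : ℝ, 0 < b → eLpNorm (slice f b) 2 volume ≠ ∞ := fun b hb =>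
      ((hC b hb).trans_lt ENNReal.coe_lt_top).ne
    set φ : ℂ → ℂ := fun s => ∫ y in (-R)..R, f (s + a + y * Complex.I) * conj (slice f x y)
      with hφ
    have hbound : ∀ s : ℂ, 0 ≤ s.re → ‖φ s‖ₑ ≤
        eLpNorm (slice f (s.re + a)) 2 volume * eLpNorm g 2 volume := by
      intro s hs
      have hc' := continuous_slice hf.differentiableOn (add_pos_of_nonneg_of_pos hs ha)
      have h1 : φ s = ∫ y, conj (g y) * slice f (s.re + a) (s.im + y) := by
        rw [hφ]; dsimp only
        rw [intervalIntegral.integral_of_le (by linarith), ← integral_Icc_eq_integral_Ioc,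
          ← integral_indicator measurableSet_Icc]
        congr 1; ext y
        have e : s + a + y * Complex.I
            = ((s.re + a : ℝ) : ℂ) + ((s.im + y : ℝ) : ℂ) * Complex.I := by
          apply Complex.ext <;> simp
        by_cases hy : y ∈ Icc (-R) R
        · rw [hg, indicator_of_mem hy, indicator_of_mem hy, e, mul_comm, slice]; rfl
        · simp [hg, hy]
      rw [h1, ← eLpNorm_slice_translate f _ s.im hc', mul_comm]
      refine (enorm_integral_le_lintegral_enorm _).trans ?_
      rw [← eLpNorm_one_eq_lintegral_enorm]
      have := eLpNorm_smul_le_mul_eLpNorm (p := 2) (q := 2) (r := 1) (μ := volume)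
        (f := fun y => slice f (s.re + a) (s.im + y)) (φ := fun y => conj (g y))
        (hc'.comp (continuous_const.add continuous_id)).aestronglyMeasurable
        (Complex.continuous_conj.comp_aestronglyMeasurable hgm)
      refine this.trans_eq ?_
      congr 1
      exact eLpNorm_congr_norm_ae (by simp)
    have hφd : DifferentiableOn ℂ φ {s | -a < s.re} := by
      intro s₀ hs₀
      have hs₀' : 0 < s₀.re + a := by
        have : -a < s₀.re := hs₀
        linarith
      set ε := (s₀.re + a) / 2 with hε
      have hε0 : 0 < ε := by positivity
      have hmem : ∀ s ∈ Metric.closedBall s₀ ε, ∀ y : ℝ,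
          s + a + y * Complex.I ∈ rightHalfPlane := by
        intro s hs y
        have h1 : |s.re - s₀.re| ≤ ε := by
          rw [← Complex.sub_re]
          exact (Complex.abs_re_le_norm _).trans (by simpa [dist_eq_norm] using hs)
        have h2 := (abs_le.mp h1).1
        simp only [rightHalfPlane, mem_ofPred_eq, Complex.add_re, Complex.ofReal_re,
          Complex.mul_re, Complex.I_re, Complex.I_im, Complex.ofReal_im, mul_zero, mul_one,
          sub_zero]
        linarith
      have hd' := (hf.differentiableOn.deriv isOpen_rightHalfPlane).continuousOn
      have hcd : ContinuousOn (fun p : ℂ × ℝ =>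
          deriv f (p.1 + a + p.2 * Complex.I) * conj (slice f x p.2))
          (Metric.closedBall s₀ ε ×ˢ Icc (-R) R) := by
        refine ContinuousOn.mul ?_ ?_
        · exact hd'.comp (by fun_prop) fun p hp => hmem p.1 hp.1 p.2
        · exact (Complex.continuous_conj.comp (hcx.comp continuous_snd)).continuousOn
      obtain ⟨M, hM⟩ := ((isCompact_closedBall s₀ ε).prod isCompact_Icc).exists_bound_of_continuousOn
        hcd
      have hci : ∀ s ∈ Metric.closedBall s₀ ε, Continuous fun y : ℝ =>
          f (s + a + y * Complex.I) * conj (slice f x y) := fun s hs =>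
        (hf.differentiableOn.continuousOn.comp_continuous (by fun_prop) (hmem s hs)).mul
          (Complex.continuous_conj.comp hcx)
      have hcF : Continuous fun y : ℝ =>
          deriv f (s₀ + a + y * Complex.I) * conj (slice f x y) :=
        (hd'.comp_continuous (by fun_prop) (hmem s₀ (Metric.mem_closedBall_self hε0.le))).mul
          (Complex.continuous_conj.comp hcx)
      have := intervalIntegral.hasDerivAt_integral_of_dominated_loc_of_deriv_le
        (F := fun s y => f (s + a + y * Complex.I) * conj (slice f x y))
        (F' := fun s y => deriv f (s + a + y * Complex.I) * conj (slice f x y))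
        (a := -R) (b := R) (μ := volume) (bound := fun _ => M)
        (Metric.closedBall_mem_nhds s₀ hε0)
        (by
          filter_upwards [Metric.closedBall_mem_nhds s₀ hε0] with s hs
          exact (hci s hs).aestronglyMeasurable)
        ((hci s₀ (Metric.mem_closedBall_self hε0.le)).intervalIntegrable _ _)
        hcF.aestronglyMeasurable
        (by
          refine Eventually.of_forall fun y hy s hs => hM (s, y) ⟨hs, ?_⟩
          rw [uIoc_of_le (by linarith)] at hy
          exact ⟨hy.1.le, hy.2⟩)
        (by simp)
        (by
          refine Eventually.of_forall fun y hy s hs => ?_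
          have h1 := (hf.differentiableOn.differentiableAt
            (isOpen_rightHalfPlane.mem_nhds (hmem s hs y))).hasDerivAt
          have h2 : HasDerivAt (fun s : ℂ => s + a + y * Complex.I) 1 s :=
            ((hasDerivAt_id s).add_const _).add_const _
          simpa using (h1.comp s h2).mul_const (conj (slice f x y)))
      exact this.2.differentiableAt.differentiableWithinAt
    have hdc : DiffContOnCl ℂ φ {s | 0 < s.re} := by
      refine DifferentiableOn.diffContOnCl ?_
      rw [Complex.closure_setOfPred_lt_re]
      exact hφd.mono fun s hs => by
        have : (0:ℝ) ≤ s.re := hs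
        show -a < s.re
        linarith
    have hub : ∀ s : ℂ, 0 ≤ s.re → ‖φ s‖ ≤ C * C := by
      intro s hs
      have := (hbound s hs).trans (mul_le_mul' (hC _ (add_pos_of_nonneg_of_pos hs ha)) hgle)
      rw [← ENNReal.coe_mul, enorm_le_coe] at this
      exact_mod_cast this
    have hfin := PhragmenLindelof.right_half_plane_of_bounded_on_real
      (C := (eLpNorm (slice f a) 2 volume * eLpNorm g 2 volume).toReal) (f := φ)
      (z := ((x - a : ℝ) : ℂ)) hdc ⟨1, by norm_num, 0, ?_⟩ ?_ ?_ (by simpa using hax)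
    · have hval : ‖φ ((x - a : ℝ) : ℂ)‖ₑ = eLpNorm g 2 volume ^ 2 := by
        have e1 : φ ((x - a : ℝ) : ℂ) = ((∫ y in Icc (-R) R, ‖slice f x y‖ ^ 2 : ℝ) : ℂ) := by
          rw [hφ]; dsimp only
          rw [intervalIntegral.integral_of_le (by linarith), ← integral_Icc_eq_integral_Ioc,
            ← integral_complex_ofReal]
          congr 1; ext y
          rw [show ((x - a : ℝ) : ℂ) + a + y * Complex.I = x + y * Complex.I by
            push_cast; ring]
          simpa [slice] using Complex.mul_conj' (slice f x y)
        have hint : IntegrableOn (fun y => ‖slice f x y‖ ^ 2) (Icc (-R) R) volume :=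
          ((hcx.norm.pow 2).continuousOn).integrableOn_compact isCompact_Icc
        rw [hg2, e1, ← ofReal_norm, Complex.norm_real, Real.norm_of_nonneg
          (integral_nonneg fun _ => by positivity),
          ofReal_integral_eq_lintegral_ofReal hint (Eventually.of_forall fun _ => by positivity)]
        congr 1; ext y
        rw [ENNReal.ofReal_pow (norm_nonneg _), ofReal_norm]
      have h2 : eLpNorm g 2 volume ^ 2 ≤ eLpNorm (slice f a) 2 volume * eLpNorm g 2 volume := by
        rw [← hval, ← ENNReal.ofReal_toReal (ENNReal.mul_ne_top (hsa a ha) hgtop),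
          ← ofReal_norm]
        exact ENNReal.ofReal_le_ofReal hfin
      rw [← hg2]
      refine pow_le_pow_left₀ (by positivity) ?_ 2
      by_cases h0 : eLpNorm g 2 volume = 0
      · simp [h0]
      · rw [sq] at h2
        exact (ENNReal.mul_le_mul_iff_left h0 hgtop).mp h2
    · refine Asymptotics.IsBigO.of_bound (C * C) ?_
      filter_upwards [mem_inf_of_right (mem_principal_self _)] with s hs
      simpa using hub s (le_of_lt hs)
    · refine ⟨C * C, ?_⟩
      rw [eventually_map]
      filter_upwards [eventually_ge_atTop 0] with t ht
      exact hub t (by simpa using ht)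
    · intro t
      have := hbound (t * Complex.I) (by simp)
      rw [← toReal_enorm]
      refine ENNReal.toReal_mono (ENNReal.mul_ne_top (hsa a ha) hgtop) ?_
      simpa using this
  rw [← ENNReal.pow_le_pow_left_iff (two_ne_zero), eLpNorm_two_sq]
  have hcov := aecover_Icc (μ := (volume : Measure ℝ)) (l := (atTop : Filter ℝ))
    (a := fun R => -R) (b := fun R => R) tendsto_neg_atTop_atBot tendsto_id
  refine le_of_tendsto (hcov.lintegral_tendsto_of_countably_generated
    (f := fun y => ‖slice f x y‖ₑ ^ 2) (hcx.enorm.measurable.pow_const 2).aemeasurable) ?_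
  filter_upwards [eventually_ge_atTop 0] with R hR
  exact key R hR

theorem enorm_sq_mul_le {f : ℂ → ℂ} (hf : DifferentiableOn ℂ f rightHalfPlane) {w : ℂ} {r : ℝ}
    (hr : 0 < r) (hw : r < w.re) :
    ENNReal.ofReal (Real.pi * r ^ 2) * ‖f w‖ₑ ^ 2 ≤ ∫⁻ z in Metric.ball w r, ‖f z‖ₑ ^ 2 := by
  set u : ℂ → ℝ≥0∞ := fun z => (Metric.ball w r).indicator (fun z => ‖f z‖ₑ ^ 2) (w + z) with hu
  have hsub : Metric.closedBall w r ⊆ rightHalfPlane := by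
    intro z hz
    have h1 : |z.re - w.re| ≤ r := by
      rw [← Complex.sub_re]
      exact (Complex.abs_re_le_norm _).trans (by simpa [dist_eq_norm] using hz)
    have h2 := (abs_le.mp h1).1
    show 0 < z.re
    linarith
  have hum : Measurable u := by
    have h0 : Measurable ((Metric.ball w r).indicator (fun z => ‖f z‖ₑ ^ 2)) := by
      classical
      have h1 := (ContinuousOn.measurable_piecewise (f := f)
        (g := fun _ => (0 : ℂ)) (s := Metric.ball w r)
        (hf.continuousOn.mono (Metric.ball_subset_closedBall.trans hsub))
        continuousOn_const Metric.isOpen_ball.measurableSet)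
      convert h1.enorm.pow_const 2 using 2 with z
      by_cases hz : z ∈ Metric.ball w r <;> simp only [indicator, piecewise, hz] <;> simp
    exact h0.comp (measurable_const_add w)
  have hmean : ∀ ρ ∈ Ioo (0 : ℝ) r, ENNReal.ofReal (2 * Real.pi) * ‖f w‖ₑ ^ 2 ≤
      ∫⁻ θ in Ioo (-Real.pi) Real.pi, u (Complex.polarCoord.symm (ρ, θ)) := by
    intro ρ hρ
    have hsub' : Metric.closedBall w |ρ| ⊆ rightHalfPlane := by
      rw [abs_of_pos hρ.1]
      exact (Metric.closedBall_subset_closedBall hρ.2.le).trans hsub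
    have hdc : DiffContOnCl ℂ (fun z => f z ^ 2) (Metric.ball w |ρ|) :=
      DifferentiableOn.diffContOnCl
        ((hf.pow 2).mono (Metric.closure_ball_subset_closedBall.trans hsub'))
    have h1 := hdc.circleAverage
    rw [Real.circleAverage_eq_integral_add (-Real.pi), intervalIntegral.integral_comp_add_right
      (fun θ => f (circleMap w ρ θ) ^ 2)] at h1
    have h2 : ENNReal.ofReal (2 * Real.pi) * ‖f w‖ₑ ^ 2 =
        ‖∫ θ in (0 + -Real.pi)..(2 * Real.pi + -Real.pi), f (circleMap w ρ θ) ^ 2‖ₑ := by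
      rw [← enorm_pow, ← h1, enorm_smul, ← mul_assoc, Real.enorm_eq_ofReal (by positivity),
        ← ENNReal.ofReal_mul (by positivity), mul_inv_cancel₀ (by positivity)]
      simp
    rw [h2, intervalIntegral.integral_of_le (by linarith [Real.pi_pos]),
      show 0 + -Real.pi = -Real.pi by ring, show 2 * Real.pi + -Real.pi = Real.pi by ring,
      integral_Ioc_eq_integral_Ioo]
    refine (enorm_integral_le_lintegral_enorm _).trans (lintegral_mono fun θ => ?_)
    have e : w + Complex.polarCoord.symm (ρ, θ) = circleMap w ρ θ := by
      rw [Complex.polarCoord_symm_apply, circleMap, Complex.exp_mul_I]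
      push_cast; rfl
    have hmem : circleMap w ρ θ ∈ Metric.ball w r := by
      simpa [circleMap, dist_eq_norm, abs_of_pos hρ.1] using hρ.2
    rw [hu]; dsimp only
    rw [e, indicator_of_mem hmem, enorm_pow]
  have htr : ∫⁻ z, u z = ∫⁻ z in Metric.ball w r, ‖f z‖ₑ ^ 2 := by
    rw [← lintegral_indicator Metric.isOpen_ball.measurableSet]
    exact lintegral_add_left_eq_self
      ((Metric.ball w r).indicator (fun z => ‖f z‖ₑ ^ 2)) w
  rw [← htr, ← Complex.lintegral_comp_polarCoord_symm, polarCoord_target,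
    Measure.volume_eq_prod, ← Measure.prod_restrict, lintegral_prod]
  · calc ENNReal.ofReal (Real.pi * r ^ 2) * ‖f w‖ₑ ^ 2
        = ∫⁻ ρ in Ioo 0 r, ENNReal.ofReal ρ * (ENNReal.ofReal (2 * Real.pi) * ‖f w‖ₑ ^ 2) := by
          have hint : ∫⁻ ρ in Ioo 0 r, ENNReal.ofReal ρ = ENNReal.ofReal (r ^ 2 / 2) := by
            rw [← ofReal_integral_eq_lintegral_ofReal, ← integral_Ioc_eq_integral_Ioo,
              ← intervalIntegral.integral_of_le hr.le, integral_id]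
            · congr 1; ring
            · exact (continuous_id.integrableOn_Icc).mono_set Ioo_subset_Icc_self
            · exact (ae_restrict_iff' measurableSet_Ioo).mpr
                (Eventually.of_forall fun x hx => hx.1.le)
          rw [lintegral_mul_const _ ENNReal.measurable_ofReal, hint, ← mul_assoc,
            ← ENNReal.ofReal_mul (by positivity)]
          congr 2; ring
      _ ≤ ∫⁻ ρ in Ioo 0 r, ∫⁻ θ in Ioo (-Real.pi) Real.pi,
            ENNReal.ofReal ρ * u (Complex.polarCoord.symm (ρ, θ)) := by
          refine setLIntegral_mono' measurableSet_Ioo fun ρ hρ => ?_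
          rw [lintegral_const_mul' _ _ ENNReal.ofReal_ne_top]
          gcongr
          exact hmean ρ hρ
      _ ≤ _ := lintegral_mono_set Ioo_subset_Ioi_self
  · refine Measurable.aemeasurable ?_
    refine (ENNReal.measurable_ofReal.comp measurable_fst).smul (hum.comp ?_)
    have : Continuous fun p : ℝ × ℝ => Complex.polarCoord.symm p := by
      simp only [Complex.polarCoord_symm_apply]
      fun_prop
    exact this.measurable

/-- Point evaluations are controlled by the slice norms. -/
theorem IsHardy.enorm_sq_le {f : ℂ → ℂ} (hf : IsHardy f) {C : ℝ≥0∞}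
    (hC : ∀ x : ℝ, 0 < x → eLpNorm (slice f x) 2 volume ≤ C) {w : ℂ} (hw : 0 < w.re) :
    ENNReal.ofReal (w.re / 2) * ‖f w‖ₑ ^ 2 ≤ C ^ 2 := by
  set r := w.re / 2 with hrdef
  have hr : 0 < r := by positivity
  have hre : ∀ z ∈ Metric.ball w r, z.re ∈ Ioo (w.re - r) (w.re + r) := by
    intro z hz
    have h1 : |z.re - w.re| < r := by
      rw [← Complex.sub_re]
      exact (Complex.abs_re_le_norm _).trans_lt (by simpa [dist_eq_norm] using hz)
    have h2 := abs_lt.mp h1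
    exact ⟨by linarith [h2.1], by linarith [h2.2]⟩
  have hsub : Metric.ball w r ⊆ rightHalfPlane := fun z hz => by
    have := (hre z hz).1
    show 0 < z.re
    linarith
  have h1 := enorm_sq_mul_le hf.differentiableOn hr (w := w) (by linarith)
  have h2 : ∫⁻ z in Metric.ball w r, ‖f z‖ₑ ^ 2 ≤ ENNReal.ofReal (2 * r) * C ^ 2 := by
    set g : ℂ → ℝ≥0∞ := (Metric.ball w r).indicator (fun z => ‖f z‖ₑ ^ 2) with hg
    have hgm : Measurable g := by
      classical
      have h1 := (ContinuousOn.measurable_piecewise (f := f)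
        (g := fun _ => (0 : ℂ)) (s := Metric.ball w r)
        (hf.differentiableOn.continuousOn.mono hsub)
        continuousOn_const Metric.isOpen_ball.measurableSet)
      convert h1.enorm.pow_const 2 using 2 with z
      by_cases hz : z ∈ Metric.ball w r <;> simp only [hg, indicator, piecewise, hz] <;> simp
    have hgle : ∀ x y : ℝ, g (Complex.measurableEquivRealProd.symm (x, y)) ≤
        (Ioo (w.re - r) (w.re + r)).indicator (fun x => ‖slice f x y‖ₑ ^ 2) x := by
      intro x y
      by_cases hz : Complex.measurableEquivRealProd.symm (x, y) ∈ Metric.ball w r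
      · have hx := hre _ hz
        rw [hg, indicator_of_mem hz, Complex.measurableEquivRealProd_symm_apply]
        rw [Complex.measurableEquivRealProd_symm_apply] at hx
        rw [indicator_of_mem hx, slice, ← Complex.mk_eq_add_mul_I]
      · rw [hg, indicator_of_notMem hz]
        exact zero_le
    rw [← lintegral_indicator Metric.isOpen_ball.measurableSet, ← hg,
      ← (Complex.volume_preserving_equiv_real_prod.symm).lintegral_comp_emb
      Complex.measurableEquivRealProd.symm.measurableEmbedding, Measure.volume_eq_prod,
      lintegral_prod (fun p => g (Complex.measurableEquivRealProd.symm p))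
        (hgm.comp Complex.measurableEquivRealProd.symm.measurable).aemeasurable]
    calc _ ≤ ∫⁻ x, (Ioo (w.re - r) (w.re + r)).indicator (fun _ => C ^ 2) x := by
          refine lintegral_mono fun x => ?_
          refine (lintegral_mono fun y => hgle x y).trans ?_
          by_cases hx : x ∈ Ioo (w.re - r) (w.re + r)
          · simp only [indicator_of_mem hx]
            rw [← eLpNorm_two_sq]
            exact pow_le_pow_left₀ zero_le (hC x (by linarith [hx.1])) 2
          · simp [indicator_of_notMem hx]
      _ = _ := by
          rw [lintegral_indicator measurableSet_Ioo, setLIntegral_const, Real.volume_Ioo, mul_comm]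
          congr 2; ring
  have h3 : ENNReal.ofReal (2 * r) * (ENNReal.ofReal r * ‖f w‖ₑ ^ 2) ≤
      ENNReal.ofReal (2 * r) * C ^ 2 := by
    refine le_trans ?_ (h1.trans h2)
    rw [← mul_assoc, ← ENNReal.ofReal_mul (by positivity)]
    refine mul_le_mul' (ENNReal.ofReal_le_ofReal ?_) le_rfl
    nlinarith [Real.two_le_pi, mul_pos hr hr]
  exact (ENNReal.mul_le_mul_iff_right (by simpa using hr) ENNReal.ofReal_ne_top).mp h3

theorem memLp_slice {f : ℂ → ℂ} (hf : IsHardy f) {x : ℝ} (hx : 0 < x) :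
    MemLp (slice f x) 2 volume := by
  obtain ⟨C, hC⟩ := hf.bounded
  exact ⟨(continuous_slice hf.differentiableOn hx).aestronglyMeasurable,
    (hC x hx).trans_lt ENNReal.coe_lt_top⟩

/-- The slices of a Hardy function are bounded in `L²` by the boundary function. -/
theorem HasBoundary.eLpNorm_slice_le {f : ℂ → ℂ} {F : Lp ℂ 2 (volume : Measure ℝ)}
    (hf : HasBoundary f F) {x : ℝ} (hx : 0 < x) : eLpNorm (slice f x) 2 volume ≤ ‖F‖ₑ := by
  have h1 : Tendsto (fun a : ℝ => eLpNorm (fun y => slice f a y - F y) 2 volume + ‖F‖ₑ)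
      (𝓝[>] 0) (𝓝 (0 + ‖F‖ₑ)) := hf.tendsto.add tendsto_const_nhds
  rw [zero_add] at h1
  refine ge_of_tendsto h1 ?_
  filter_upwards [Ioc_mem_nhdsGT hx] with a ha
  refine (hf.toIsHardy.eLpNorm_slice_le ha.1 ha.2).trans ?_
  rw [Lp.enorm_def]
  have hm := (continuous_slice hf.differentiableOn ha.1).aestronglyMeasurable (μ := volume)
  have := eLpNorm_add_le (p := 2) (hm.sub (Lp.aestronglyMeasurable F)) (Lp.aestronglyMeasurable F)
    (by norm_num)
  simpa using! this

theorem HasBoundary.zero : HasBoundary 0 0 where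
  differentiableOn := differentiableOn_const 0
  bounded := ⟨0, fun x _ => by
    have : slice 0 x = 0 := rfl
    simp [this]⟩
  tendsto := by
    refine tendsto_const_nhds.congr fun x => ?_
    rw [eLpNorm_congr_ae (g := 0)]
    · simp
    · filter_upwards [Lp.coeFn_zero ℂ 2 (volume : Measure ℝ)] with y hy
      simp [slice]

theorem HasBoundary.add {f g : ℂ → ℂ} {F G : Lp ℂ 2 (volume : Measure ℝ)}
    (hf : HasBoundary f F) (hg : HasBoundary g G) : HasBoundary (f + g) (F + G) where
  differentiableOn := hf.differentiableOn.add hg.differentiableOn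
  bounded := by
    obtain ⟨C, hC⟩ := hf.bounded
    obtain ⟨D, hD⟩ := hg.bounded
    refine ⟨C + D, fun x hx => ?_⟩
    push_cast
    exact (eLpNorm_add_le (memLp_slice hf.toIsHardy hx).1 (memLp_slice hg.toIsHardy hx).1
      (by norm_num)).trans (add_le_add (hC x hx) (hD x hx))
  tendsto := by
    have h := hf.tendsto.add hg.tendsto
    rw [zero_add] at h
    refine tendsto_of_tendsto_of_tendsto_of_le_of_le' tendsto_const_nhds h
      (Eventually.of_forall fun _ => zero_le) ?_
    filter_upwards [self_mem_nhdsWithin] with x hx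
    have := eLpNorm_add_le (p := 2)
      ((memLp_slice hf.toIsHardy hx).1.sub (Lp.aestronglyMeasurable F))
      ((memLp_slice hg.toIsHardy hx).1.sub (Lp.aestronglyMeasurable G)) (by norm_num)
    refine le_trans (le_of_eq (eLpNorm_congr_ae ?_)) this
    filter_upwards [Lp.coeFn_add F G] with y hy
    simp only [hy, slice, Pi.add_apply, Pi.sub_apply]
    ring

theorem HasBoundary.smul {f : ℂ → ℂ} {F : Lp ℂ 2 (volume : Measure ℝ)} (c : ℂ)
    (hf : HasBoundary f F) : HasBoundary (c • f) (c • F) where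
  differentiableOn := hf.differentiableOn.const_smul c
  bounded := by
    obtain ⟨C, hC⟩ := hf.bounded
    refine ⟨‖c‖₊ * C, fun x hx => ?_⟩
    have : slice (c • f) x = c • slice f x := rfl
    rw [this, eLpNorm_const_smul]
    push_cast
    exact mul_le_mul' le_rfl (hC x hx)
  tendsto := by
    have h := ENNReal.Tendsto.const_mul (a := ‖c‖ₑ) hf.tendsto (Or.inr enorm_ne_top)
    rw [mul_zero] at h
    refine h.congr fun x => ?_
    rw [← eLpNorm_const_smul]
    refine eLpNorm_congr_ae ?_
    filter_upwards [Lp.coeFn_smul c F] with y hy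
    simp [hy, slice, mul_sub]

/-- The Hardy space `H²(ℂ₊)`, each function being identified with its boundary function on the
imaginary axis; the inner product is that of `L²(iℝ, dy)`. -/
def H2 : Submodule ℂ (Lp ℂ 2 (volume : Measure ℝ)) where
  carrier := {F | ∃ f : ℂ → ℂ, HasBoundary f F}
  zero_mem' := ⟨0, .zero⟩
  add_mem' := fun ⟨f, hf⟩ ⟨g, hg⟩ => ⟨f + g, hf.add hg⟩
  smul_mem' := fun c _ ⟨f, hf⟩ => ⟨c • f, hf.smul c⟩

theorem isClosed_H2 : IsClosed (H2 : Set (Lp ℂ 2 (volume : Measure ℝ))) := by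
  refine isSeqClosed_iff_isClosed.mp fun Fs F hFs hlim => ?_
  choose fs hfs using hFs
  obtain ⟨b, hb0, hb, hblim⟩ := cauchySeq_iff_le_tendsto_0.mp hlim.cauchySeq
  have hdiff : ∀ j k, HasBoundary (fun s => fs j s - fs k s) (Fs j - Fs k) := by
    intro j k
    have := (hfs j).add ((hfs k).smul (-1))
    convert this using 1
    · ext s; simp [sub_eq_add_neg]
    · simp [sub_eq_add_neg]
  have hsl : ∀ N, ∀ j ≥ N, ∀ k ≥ N, ∀ x : ℝ, 0 < x →
      eLpNorm (slice (fun s => fs j s - fs k s) x) 2 volume ≤ ENNReal.ofReal (b N) := by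
    intro N j hj k hk x hx
    refine ((hdiff j k).eLpNorm_slice_le hx).trans ?_
    rw [← ofReal_norm, ← dist_eq_norm]
    exact ENNReal.ofReal_le_ofReal (hb j k N hj hk)
  have hpt : ∀ N, ∀ j ≥ N, ∀ k ≥ N, ∀ w : ℂ, 0 < w.re →
      w.re / 2 * dist (fs j w) (fs k w) ^ 2 ≤ b N ^ 2 := by
    intro N j hj k hk w hw
    have h := (hdiff j k).toIsHardy.enorm_sq_le (hsl N j hj k hk) hw
    rw [← ofReal_norm, ← ENNReal.ofReal_pow (norm_nonneg _), ← ENNReal.ofReal_pow (hb0 N),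
      ← ENNReal.ofReal_mul (by positivity), ENNReal.ofReal_le_ofReal_iff (by positivity)] at h
    rwa [dist_eq_norm]
  have hpt' : ∀ N, ∀ j ≥ N, ∀ k ≥ N, ∀ w : ℂ, 0 < w.re →
      dist (fs j w) (fs k w) ≤ b N / √(w.re / 2) := by
    intro N j hj k hk w hw
    rw [le_div_iff₀ (by positivity)]
    refine abs_le_of_sq_le_sq' ?_ (hb0 N) |>.2
    rw [mul_pow, Real.sq_sqrt (by positivity), mul_comm]
    exact hpt N j hj k hk w hw
  have hex : ∀ w : ℂ, ∃ z, 0 < w.re → Tendsto (fun j => fs j w) atTop (𝓝 z) := by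
    intro w
    by_cases hw : 0 < w.re
    · have hc : CauchySeq fun j => fs j w := by
        refine cauchySeq_of_le_tendsto_0 (fun N => b N / √(w.re / 2))
          (fun j k N hj hk => hpt' N j hj k hk w hw) ?_
        simpa using hblim.div_const (√(w.re / 2))
      obtain ⟨z, hz⟩ := cauchySeq_tendsto_of_complete hc
      exact ⟨z, fun _ => hz⟩
    · exact ⟨0, fun h => absurd h hw⟩
  choose f hf using hex
  have hptf : ∀ N, ∀ w : ℂ, 0 < w.re → dist (f w) (fs N w) ≤ b N / √(w.re / 2) := by
    intro N w hw
    refine le_of_tendsto ((hf w hw).dist tendsto_const_nhds) ?_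
    filter_upwards [eventually_ge_atTop N] with j hj
    exact hpt' N j hj N le_rfl w hw
  have hslf : ∀ N, ∀ x : ℝ, 0 < x →
      eLpNorm (fun y => slice f x y - slice (fs N) x y) 2 volume ≤ ENNReal.ofReal (b N) := by
    intro N x hx
    refine (Lp.eLpNorm_lim_le_liminf_eLpNorm (p := 2)
      (f := fun j => slice (fun s => fs j s - fs N s) x)
      (fun j => (memLp_slice (hdiff j N).toIsHardy hx).1) _
      (Eventually.of_forall fun y => ((hf _ (by simpa using hx)).sub_const _))).trans ?_
    refine liminf_le_of_frequently_le' (Eventually.frequently ?_)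
    filter_upwards [eventually_ge_atTop N] with j hj
    exact hsl N j hj N le_rfl x hx
  have hdf : DifferentiableOn ℂ f rightHalfPlane := by
    refine TendstoLocallyUniformlyOn.differentiableOn (F := fs) (φ := atTop) ?_
      (Eventually.of_forall fun j => (hfs j).differentiableOn) isOpen_rightHalfPlane
    rw [Metric.tendstoLocallyUniformlyOn_iff]
    intro ε hε w hw
    have hw' : 0 < w.re := hw
    refine ⟨{z | w.re / 2 < z.re}, mem_nhdsWithin_of_mem_nhds
      ((isOpen_lt continuous_const Complex.continuous_re).mem_nhds (by
        show w.re / 2 < w.re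
        linarith)), ?_⟩
    have h0 : Tendsto (fun N => b N / √(w.re / 4)) atTop (𝓝 0) := by
      simpa using hblim.div_const (√(w.re / 4))
    filter_upwards [h0.eventually_lt_const hε] with N hN z hz
    have hz' : w.re / 2 < z.re := hz
    refine lt_of_le_of_lt ((hptf N z (by linarith)).trans ?_) hN
    refine div_le_div_of_nonneg_left (hb0 N) (by positivity) (Real.sqrt_le_sqrt ?_)
    linarith
  have hmeas : ∀ x : ℝ, 0 < x → AEStronglyMeasurable (slice f x) volume := fun x hx =>
    (continuous_slice hdf hx).aestronglyMeasurable
  refine ⟨f, ⟨hdf, ?_⟩, ?_⟩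
  · obtain ⟨C, hC⟩ := (hfs 0).bounded
    refine ⟨Real.toNNReal (b 0) + C, fun x hx => ?_⟩
    push_cast
    have hm := (memLp_slice (hfs 0).toIsHardy hx).1
    have h := eLpNorm_add_le (p := 2) ((hmeas x hx).sub hm) hm (by norm_num)
    rw [sub_add_cancel] at h
    exact h.trans (add_le_add (hslf 0 x hx) (hC x hx))
  · rw [ENNReal.tendsto_nhds_zero]
    intro ε hε
    have hF : Tendsto (fun N => ENNReal.ofReal (b N) + ‖Fs N - F‖ₑ) atTop (𝓝 0) := by
      have h1 := ENNReal.tendsto_ofReal hblim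
      have h2 : Tendsto (fun N => ‖Fs N - F‖ₑ) atTop (𝓝 0) := by
        have := (hlim.sub_const F).enorm
        simpa using this
      simpa using h1.add h2
    obtain ⟨N, hN⟩ := (hF.eventually_lt_const (ENNReal.half_pos hε.ne')).exists
    filter_upwards [(ENNReal.tendsto_nhds_zero.mp (hfs N).tendsto) _ (ENNReal.half_pos hε.ne'),
      self_mem_nhdsWithin] with x hx1 hx
    have hm := (memLp_slice (hfs N).toIsHardy hx).1
    have hFm := Lp.aestronglyMeasurable F
    have hFN := Lp.aestronglyMeasurable (Fs N)
    have h1 := eLpNorm_add_le (p := 2) ((hmeas x hx).sub hm)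
      ((hm.sub hFN).add (hFN.sub hFm)) (by norm_num)
    have h2 := eLpNorm_add_le (p := 2) (hm.sub hFN) (hFN.sub hFm) (by norm_num)
    have e : (slice f x - slice (fs N) x) + ((slice (fs N) x - ⇑(Fs N)) + (⇑(Fs N) - ⇑F)) =
        fun y => slice f x y - F y := by
      ext y; simp
    have e2 : eLpNorm (⇑(Fs N) - ⇑F) 2 volume = ‖Fs N - F‖ₑ := by
      rw [Lp.enorm_def]
      exact eLpNorm_congr_ae (Lp.coeFn_sub _ _).symm
    rw [e] at h1
    rw [e2] at h2
    refine h1.trans ((add_le_add (hslf N x hx) h2).trans ?_)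
    calc _ = (ENNReal.ofReal (b N) + ‖Fs N - F‖ₑ)
            + eLpNorm (fun y => slice (fs N) x y - Fs N y) 2 volume := by
          rw [add_comm (eLpNorm _ _ _), ← add_assoc]; rfl
      _ ≤ ε / 2 + ε / 2 := add_le_add hN.le hx1
      _ = ε := ENNReal.add_halves ε

instance : CompleteSpace H2 := isClosed_H2.completeSpace_coe

theorem norm_exp_boundary (t y : ℝ) : ‖Complex.exp (-(t * (y * Complex.I)))‖ = 1 := by
  rw [Complex.norm_exp]; simp

theorem memLp_exp_mul (t : ℝ) (F : Lp ℂ 2 (volume : Measure ℝ)) :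
    MemLp (fun y : ℝ => Complex.exp (-(t * (y * Complex.I))) * F y) 2 volume :=
  (memLp_congr_norm (((by fun_prop : Continuous fun y : ℝ =>
      Complex.exp (-(t * (y * Complex.I)))).aestronglyMeasurable).mul (Lp.aestronglyMeasurable F))
    (Lp.aestronglyMeasurable F)
    (Eventually.of_forall fun y => by simp [norm_exp_boundary])).mpr (Lp.memLp F)

/-- Multiplication by `y ↦ e^{-i t y}`, the boundary function of `s ↦ e^{-t s}`, on `L²(ℝ)`. -/
noncomputable def expMul (t : ℝ) :
    Lp ℂ 2 (volume : Measure ℝ) →ₗᵢ[ℂ] Lp ℂ 2 (volume : Measure ℝ) where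
  toFun F := (memLp_exp_mul t F).toLp _
  map_add' F G := by
    rw [← MemLp.toLp_add (memLp_exp_mul t F) (memLp_exp_mul t G)]
    refine MemLp.toLp_congr _ _ ?_
    filter_upwards [Lp.coeFn_add F G] with y hy
    rw [hy, Pi.add_apply, Pi.add_apply, mul_add]
  map_smul' c F := by
    rw [RingHom.id_apply, ← MemLp.toLp_const_smul c (memLp_exp_mul t F)]
    refine MemLp.toLp_congr _ _ ?_
    filter_upwards [Lp.coeFn_smul c F] with y hy
    rw [hy, Pi.smul_apply, Pi.smul_apply, smul_eq_mul, smul_eq_mul, mul_left_comm]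
  norm_map' F := by
    change ‖(memLp_exp_mul t F).toLp _‖ = ‖F‖
    rw [Lp.norm_toLp, Lp.norm_def]
    congr 1
    exact eLpNorm_congr_norm_ae (Eventually.of_forall fun y => by simp [norm_exp_boundary])

/-- On the level of holomorphic functions, `expMul t` is multiplication by `e^{-t s}`. -/
theorem HasBoundary.exp_mul {f : ℂ → ℂ} {F : Lp ℂ 2 (volume : Measure ℝ)} (hf : HasBoundary f F)
    {t : ℝ} (ht : 0 ≤ t) :
    HasBoundary (fun s => Complex.exp (-(t * s)) * f s) (expMul t F) where
  differentiableOn := by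
    have := hf.differentiableOn
    fun_prop
  bounded := by
    obtain ⟨C, hC⟩ := hf.bounded
    refine ⟨C, fun x hx => (eLpNorm_mono fun y => ?_).trans (hC x hx)⟩
    rw [slice, norm_mul, Complex.norm_exp]
    refine mul_le_of_le_one_left (norm_nonneg _) (Real.exp_le_one_iff.mpr ?_)
    simp
    positivity
  tendsto := by
    have h1 : Tendsto (fun x : ℝ => ‖Complex.exp (-(t * x)) - 1‖ₑ) (𝓝[>] 0) (𝓝 0) := by
      have : Continuous fun x : ℝ => ‖Complex.exp (-(t * x)) - 1‖ₑ := by fun_prop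
      refine (this.tendsto' 0 0 (by simp)).mono_left nhdsWithin_le_nhds
    have h2 := hf.tendsto.add (ENNReal.Tendsto.mul_const (b := ‖F‖ₑ) h1 (Or.inr enorm_ne_top))
    rw [zero_mul, zero_add] at h2
    refine tendsto_of_tendsto_of_tendsto_of_le_of_le' tendsto_const_nhds h2
      (Eventually.of_forall fun _ => zero_le) ?_
    filter_upwards [self_mem_nhdsWithin] with x hx
    have hx0 : 0 < x := hx
    have hm := (memLp_slice hf.toIsHardy hx).1
    have hFm := Lp.aestronglyMeasurable F
    have h3 := eLpNorm_add_le (p := 2) ((hm.sub hFm).const_smul (Complex.exp (-(t * x))))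
      (hFm.const_smul (Complex.exp (-(t * x)) - 1)) (by norm_num)
    rw [eLpNorm_const_smul, eLpNorm_const_smul, ← Lp.enorm_def] at h3
    have h4 : ‖Complex.exp (-(t * x))‖ₑ ≤ 1 := by
      rw [← ofReal_norm, ENNReal.ofReal_le_one, Complex.norm_exp, Real.exp_le_one_iff]
      simp
      positivity
    refine le_trans (le_of_eq ?_) (h3.trans (add_le_add (mul_le_of_le_one_left zero_le h4) le_rfl))
    refine eLpNorm_congr_norm_ae ?_
    filter_upwards [(memLp_exp_mul t F).coeFn_toLp] with y hy
    have e : (expMul t F) y = Complex.exp (-(t * (y * Complex.I))) * F y := hy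
    have e2 : Complex.exp (-(t * (x + y * Complex.I))) =
        Complex.exp (-(t * (y * Complex.I))) * Complex.exp (-(t * x)) := by
      rw [← Complex.exp_add]; ring_nf
    rw [e, slice, e2]
    have e3 : Complex.exp (-(t * (y * Complex.I))) * Complex.exp (-(t * x)) *
          f (x + y * Complex.I) - Complex.exp (-(t * (y * Complex.I))) * F y =
        Complex.exp (-(t * (y * Complex.I))) * (Complex.exp (-(t * x)) *
          (f (x + y * Complex.I) - F y) + (Complex.exp (-(t * x)) - 1) * F y) := by ring
    rw [e3, norm_mul, norm_exp_boundary, one_mul]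
    simp [slice]

/-- The multiplication semigroup `(M(t) g)(s) = e^{-t s} g(s)` on `H²(ℂ₊)`. -/
noncomputable def multSemigroup (t : ℝ≥0) : H2 →L[ℂ] H2 :=
  ((expMul t).toContinuousLinearMap.comp H2.subtypeL).codRestrict H2 fun F => by
    obtain ⟨f, hf⟩ := F.2
    exact ⟨_, hf.exp_mul t.2⟩

/-- The smallest closed subspace of `H²(ℂ₊)` that contains all `g(s) e^{-l s}` with `0 ≤ l ≤ δ`. -/
noncomputable def cyclicSubspace (δ : ℝ) (g : ℂ → ℂ) : Submodule ℂ H2 :=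
  (Submodule.span ℂ {F : H2 | ∃ l ∈ Icc (0 : ℝ) δ,
    HasBoundary (fun s => g s * Complex.exp (-(l * s))) F}).topologicalClosure

/-- `θ` is an inner function on `ℂ₊`: holomorphic, bounded by one, with boundary values of modulus
one almost everywhere. -/
structure IsInner (θ : ℂ → ℂ) : Prop where
  differentiableOn : DifferentiableOn ℂ θ rightHalfPlane
  norm_le_one : ∀ s ∈ rightHalfPlane, ‖θ s‖ ≤ 1
  boundary : ∀ᵐ y : ℝ, Tendsto (fun x => ‖slice θ x y‖) (𝓝[>] 0) (𝓝 1)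

/-- Invariance under the backward shift semigroup `{M(t)*}`, `t ≥ 0`. -/
def IsBackwardShiftInvariant (K : Submodule ℂ H2) : Prop :=
  ∀ t : ℝ≥0, ∀ F ∈ K, ContinuousLinearMap.adjoint (multSemigroup t) F ∈ K

/-- The model space `K_θ = H²(ℂ₊) ⊖ θ H²(ℂ₊)`. Here `h` runs through the functions in `H²(ℂ₊)` and
`F` is the product `θ h`. -/
noncomputable def modelSpace (θ : ℂ → ℂ) : Submodule ℂ H2 :=
  (Submodule.span ℂ {F : H2 | ∃ (h : ℂ → ℂ) (G : H2), HasBoundary h G ∧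
    HasBoundary (fun s => θ s * h s) F})ᗮ

end HardyRHP

namespace HardyRHP

open MeasureTheory Filter Set Topology
open scoped NNReal ENNReal ComplexConjugate ContDiff

/-! Write `u = 1/(1 - iy)`, `b = (1 + iy)/(1 - iy)` and `θ` for the inner function. On the imaginary
axis `conj θ = b^(n+1) e^{iδy}`, and a generator `e^{-ls}/(1+s)^(n+1)` has conjugate `e^{ily}
u^(n+1)`.

The inclusion of the cyclic subspace in the model space is Cauchy's theorem: the conjugate generator
times `θh` equals `e^{-i(δ-l)y} (1+iy)^{-(n+1)} h`. For `l ≤ δ` this is a boundary function of `H²`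
times the Cauchy kernel `1/(1+iy)`, and its integral vanishes
(`HasBoundary.integral_mul_inv_eq_zero`).

For the reverse inclusion, pass to orthogonal complements: an `F` in `H²` orthogonal to every
generator must be `θh` with `h` in `H²`. The only candidate is `h = conj θ · F`, so the question is
whether this `L²` function is a boundary function. The test is `mem_H2_of_integral_mul_inv_eq_zero`:
it suffices that its integrals against all kernels `1/(a+iy)`, `Re a > 0`, vanish. The test itself
holds because an `L²` function that annihilates these kernels and their conjugates has zero Poisson
integrals, hence is zero.

Orthogonality says that `F` annihilates `e^{ily} u^(n+1)` for `0 ≤ l ≤ δ`. Differentiation in `l`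
gives the same for all lower powers of `u` (`integral_exp_inv_pow_eq_zero`). The power `u` leads to
a linear differential equation in `l` which carries the vanishing against `1/(a+iy)`, known at `l =
0` as `F` is in `H²`, to `l = δ` (`integral_exp_inv_add_eq_zero`). Partial fractions then insert the
factor `b^(n+1)` (`integral_exp_blaschke_inv_add_eq_zero`).

Backward shift invariance follows from the identity, since `θH²` is invariant under multiplication
by `e^{-ts}`. -/

/-! ### Dominated convergence and Cauchy–Schwarz in `L²(ℝ)` -/

theorem tendsto_eLpNorm_two_zero_of_dominated {ι : Type*} {l : Filter ι}
    [l.IsCountablyGenerated] {g : ι → ℝ → ℂ} {B : ℝ → ℂ} (hB : MemLp B 2 volume)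
    (hm : ∀ᶠ i in l, AEStronglyMeasurable (g i) volume)
    (hb : ∀ᶠ i in l, ∀ᵐ y, ‖g i y‖ ≤ ‖B y‖)
    (hlim : ∀ᵐ y, Tendsto (fun i => g i y) l (𝓝 0)) :
    Tendsto (fun i => eLpNorm (g i) 2 volume) l (𝓝 0) := by
  have h1 : Tendsto (fun i => ∫⁻ y, ‖g i y‖ₑ ^ 2) l (𝓝 (∫⁻ _ : ℝ, 0)) := by
    refine tendsto_lintegral_filter_of_dominated_convergence' (fun y => ‖B y‖ₑ ^ 2) ?_ ?_ ?_ ?_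
    · filter_upwards [hm] with i hi using hi.enorm.pow_const 2
    · filter_upwards [hb] with i hi
      filter_upwards [hi] with y hy
      exact pow_le_pow_left₀ zero_le (enorm_le_iff_norm_le.mpr hy) 2
    · rw [← eLpNorm_two_sq]
      exact ENNReal.pow_ne_top hB.2.ne
    · filter_upwards [hlim] with y hy
      exact ((ENNReal.continuous_pow 2).tendsto' 0 0 (by simp)).comp (by simpa using hy.enorm)
  simp only [lintegral_zero] at h1
  have h2 := (ENNReal.continuous_rpow_const (y := 1 / 2)).tendsto 0 |>.comp h1
  rw [ENNReal.zero_rpow_of_pos (by norm_num)] at h2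
  refine h2.congr fun i => ?_
  rw [Function.comp_apply, ← eLpNorm_two_sq, ← ENNReal.rpow_natCast, ← ENNReal.rpow_mul]
  norm_num

theorem enorm_integral_mul_le {f g : ℝ → ℂ} (hf : AEStronglyMeasurable f volume)
    (hg : AEStronglyMeasurable g volume) :
    ‖∫ y, f y * g y‖ₑ ≤ eLpNorm f 2 volume * eLpNorm g 2 volume := by
  refine (enorm_integral_le_lintegral_enorm _).trans ?_
  rw [← eLpNorm_one_eq_lintegral_enorm]
  have := eLpNorm_smul_le_mul_eLpNorm (p := 2) (q := 2) (r := 1) (μ := volume)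
    (f := g) (φ := f) hg hf
  exact this

/-! ### The Cauchy kernels `1/(a + s)` as Hardy functions -/

theorem add_mul_I_ne_zero {a : ℂ} (ha : 0 < a.re) (y : ℝ) : a + y * Complex.I ≠ 0 := by
  intro h
  have := congrArg Complex.re h
  simp at this
  exact ha.ne' this

theorem continuous_inv_add_mul_I {a : ℂ} (ha : 0 < a.re) :
    Continuous fun y : ℝ => (a + y * Complex.I)⁻¹ :=
  Continuous.inv₀ (by fun_prop) (add_mul_I_ne_zero ha)

/-- The two squares in the constant come from `1 ≤ |a+iy| / Re a` and `|y| ≤ |a+iy| + |a| ≤ (1 + |a|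
/ Re a) |a+iy|`. -/
theorem one_add_sq_le_mul_normSq {a : ℂ} (ha : 0 < a.re) (y : ℝ) :
    1 + y ^ 2 ≤ ((1 / a.re) ^ 2 + (1 + ‖a‖ / a.re) ^ 2) * ‖a + y * Complex.I‖ ^ 2 := by
  have h1 : a.re ≤ ‖a + y * Complex.I‖ := by
    simpa using Complex.re_le_norm (a + y * Complex.I)
  have h2 : |y| ≤ ‖a + y * Complex.I‖ + ‖a‖ := by
    have := norm_sub_le (a + y * Complex.I) a
    simpa using this
  have h3 : 1 ≤ 1 / a.re * ‖a + y * Complex.I‖ := by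
    rw [one_div_mul_eq_div, le_div_iff₀ ha]; linarith
  have h4 : |y| ≤ (1 + ‖a‖ / a.re) * ‖a + y * Complex.I‖ := by
    have : ‖a‖ * 1 ≤ ‖a‖ * (1 / a.re * ‖a + y * Complex.I‖) :=
      mul_le_mul_of_nonneg_left h3 (norm_nonneg _)
    calc |y| ≤ ‖a + y * Complex.I‖ + ‖a‖ := h2
      _ ≤ ‖a + y * Complex.I‖ + ‖a‖ * (1 / a.re * ‖a + y * Complex.I‖) := by linarith
      _ = _ := by ring
  have h5 := pow_le_pow_left₀ (abs_nonneg y) h4 2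
  have h6 := pow_le_pow_left₀ zero_le_one h3 2
  rw [sq_abs, mul_pow] at h5
  rw [one_pow, mul_pow] at h6
  linarith

theorem memLp_inv_add_mul_I {a : ℂ} (ha : 0 < a.re) :
    MemLp (fun y : ℝ => (a + y * Complex.I)⁻¹) 2 volume := by
  have hc := continuous_inv_add_mul_I ha
  rw [memLp_two_iff_integrable_sq_norm hc.aestronglyMeasurable]
  set D := (1 / a.re) ^ 2 + (1 + ‖a‖ / a.re) ^ 2
  refine (integrable_inv_one_add_sq.const_mul D).mono' (hc.norm.pow 2).aestronglyMeasurable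
    (Eventually.of_forall fun y => ?_)
  have h0 : 0 < ‖a + y * Complex.I‖ ^ 2 := by
    have := norm_pos_iff.mpr (add_mul_I_ne_zero ha y)
    positivity
  rw [Real.norm_of_nonneg (by positivity), norm_inv, inv_pow, inv_le_iff_one_le_mul₀ h0,
    mul_assoc, mul_left_comm, ← div_eq_inv_mul, le_div_iff₀ (by positivity), one_mul]
  exact one_add_sq_le_mul_normSq ha y

theorem norm_inv_add_le {a : ℂ} (ha : 0 < a.re) {x : ℝ} (hx : 0 ≤ x) (y : ℝ) :
    ‖(a + (x + y * Complex.I))⁻¹‖ ≤ ‖(a + y * Complex.I)⁻¹‖ := by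
  rw [norm_inv, norm_inv]
  refine inv_anti₀ (norm_pos_iff.mpr (add_mul_I_ne_zero ha y)) ?_
  rw [Complex.norm_def, Complex.norm_def]
  refine Real.sqrt_le_sqrt ?_
  simp only [Complex.normSq_apply, Complex.add_re, Complex.add_im, Complex.ofReal_re,
    Complex.ofReal_im, Complex.mul_re, Complex.mul_im, Complex.I_re, Complex.I_im]
  nlinarith

theorem add_ne_zero_of_re_pos {a s : ℂ} (ha : 0 < a.re) (hs : 0 ≤ s.re) : a + s ≠ 0 := by
  intro h
  have := congrArg Complex.re h
  simp at this
  linarith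

/-- Moving right only increases `|a + s|`, so the boundary kernel dominates every slice; this gives
both the uniform bound and the `L²` convergence. -/
theorem hasBoundary_inv_add {a : ℂ} (ha : 0 < a.re) :
    HasBoundary (fun s => (a + s)⁻¹) (memLp_inv_add_mul_I ha).toLp where
  differentiableOn := by
    refine DifferentiableOn.inv (by fun_prop) fun s hs => add_ne_zero_of_re_pos ha (le_of_lt hs)
  bounded := by
    refine ⟨(eLpNorm (fun y : ℝ => (a + y * Complex.I)⁻¹) 2 volume).toNNReal, fun x hx => ?_⟩
    rw [ENNReal.coe_toNNReal (memLp_inv_add_mul_I ha).2.ne]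
    exact eLpNorm_mono fun y => norm_inv_add_le ha hx.le y
  tendsto := by
    have hL := (memLp_inv_add_mul_I ha).coeFn_toLp
    refine tendsto_eLpNorm_two_zero_of_dominated (B := fun y => 2 * (a + y * Complex.I)⁻¹)
      ((memLp_inv_add_mul_I ha).const_mul 2) ?_ ?_ ?_
    · filter_upwards [self_mem_nhdsWithin] with x hx
      have hx' : 0 < x := hx
      have : Continuous (slice (fun s => (a + s)⁻¹) x) :=
        Continuous.inv₀ (by fun_prop) fun y => add_ne_zero_of_re_pos ha (by simpa using hx'.le)
      exact this.aestronglyMeasurable.sub (Lp.aestronglyMeasurable _)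
    · filter_upwards [self_mem_nhdsWithin] with x hx
      have hx' : 0 < x := hx
      filter_upwards [hL] with y hy
      rw [hy, slice, norm_mul]
      refine (norm_sub_le _ _).trans ?_
      have := norm_inv_add_le ha hx'.le y
      simp only [Complex.norm_ofNat]
      linarith
    · filter_upwards [hL] with y hy
      rw [hy]
      have : ContinuousAt (fun x : ℝ => (a + (x + y * Complex.I))⁻¹ - (a + y * Complex.I)⁻¹) 0 :=
        ContinuousAt.sub (ContinuousAt.inv₀ (by fun_prop)
          (by simpa using add_mul_I_ne_zero ha y)) continuousAt_const
      refine (this.tendsto.mono_left nhdsWithin_le_nhds).trans (by simp)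

/-! ### Uniqueness of boundary functions and bounded multipliers -/

theorem HasBoundary.unique {f : ℂ → ℂ} {F G : Lp ℂ 2 (volume : Measure ℝ)}
    (hF : HasBoundary f F) (hG : HasBoundary f G) : F = G := by
  have h := hF.tendsto.add hG.tendsto
  rw [zero_add] at h
  have key : eLpNorm (fun y => F y - G y) 2 volume ≤ 0 := by
    refine ge_of_tendsto h ?_
    filter_upwards [self_mem_nhdsWithin] with x hx
    have hm := (memLp_slice hF.toIsHardy hx).1
    have := eLpNorm_sub_le (p := 2) (hm.sub (Lp.aestronglyMeasurable G))
      (hm.sub (Lp.aestronglyMeasurable F)) (by norm_num)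
    rw [add_comm] at this
    refine le_trans (le_of_eq ?_) this
    congr 1; ext y; simp
  rw [← sub_eq_zero, ← enorm_eq_zero, Lp.enorm_def]
  refine le_antisymm (le_trans (le_of_eq (eLpNorm_congr_ae ?_)) key) zero_le
  exact Lp.coeFn_sub F G

/-- A bounded holomorphic multiplier, continuous up to the boundary, acts on boundary functions. -/
theorem HasBoundary.mul {f θ : ℂ → ℂ} {F : Lp ℂ 2 (volume : Measure ℝ)} (hf : HasBoundary f F)
    {M : ℝ} (hd : DifferentiableOn ℂ θ rightHalfPlane)
    (hc : ContinuousOn θ {s | 0 ≤ s.re}) (hM : ∀ s : ℂ, 0 ≤ s.re → ‖θ s‖ ≤ M)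
    {H : Lp ℂ 2 (volume : Measure ℝ)} (hH : H =ᵐ[volume] fun y => θ (y * Complex.I) * F y) :
    HasBoundary (fun s => θ s * f s) H where
  differentiableOn := hd.mul hf.differentiableOn
  bounded := by
    obtain ⟨C, hC⟩ := hf.bounded
    have hM0 : 0 ≤ M := (norm_nonneg _).trans (hM 0 (by simp))
    refine ⟨M.toNNReal * C, fun x hx => ?_⟩
    push_cast
    refine (eLpNorm_le_mul_eLpNorm_of_ae_le_mul (g := slice f x) (c := M)
      (Eventually.of_forall fun y => ?_) 2).trans (mul_le_mul' le_rfl (hC x hx))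
    rw [slice, norm_mul]
    exact mul_le_mul_of_nonneg_right (hM _ (by simpa using hx.le)) (norm_nonneg _)
  tendsto := by
    have hM0 : 0 ≤ M := (norm_nonneg _).trans (hM 0 (by simp))
    have hcl : ∀ x : ℝ, 0 ≤ x → Continuous fun y : ℝ => θ (x + y * Complex.I) := fun x hx =>
      hc.comp_continuous (by fun_prop) fun y => by simpa using hx
    -- The error splits as `θ(x+iy)(f(x+iy) - F) + (θ(x+iy) - θ(iy))F`. The second term needs only
    -- pointwise continuity of `θ` at the axis, with majorant `2M|F|`.
    have h1 : Tendsto (fun x : ℝ => eLpNorm (fun y : ℝ =>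
        (θ (x + y * Complex.I) - θ (y * Complex.I)) * F y) 2 volume) (𝓝[>] 0) (𝓝 0) := by
      refine tendsto_eLpNorm_two_zero_of_dominated (B := fun y => (2 * M : ℂ) * F y)
        ((Lp.memLp F).const_mul _) ?_ ?_ ?_
      · filter_upwards [self_mem_nhdsWithin] with x hx
        have hx' : 0 < x := hx
        have h0 := hcl 0 le_rfl
        simp only [Complex.ofReal_zero, zero_add] at h0
        exact ((hcl x hx'.le).sub h0).aestronglyMeasurable.mul (Lp.aestronglyMeasurable F)
      · filter_upwards [self_mem_nhdsWithin] with x hx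
        have hx' : 0 < x := hx
        refine Eventually.of_forall fun y => ?_
        rw [norm_mul, norm_mul]
        refine mul_le_mul_of_nonneg_right ((norm_sub_le _ _).trans ?_) (norm_nonneg _)
        have e1 := hM (x + y * Complex.I) (by simpa using hx'.le)
        have e2 := hM (y * Complex.I) (by simp)
        simp only [norm_mul, Complex.norm_ofNat, Complex.norm_real, Real.norm_of_nonneg hM0]
        linarith
      · refine Eventually.of_forall fun y => ?_
        have h2 : Tendsto (fun x : ℝ => θ (x + y * Complex.I)) (𝓝[>] 0)
            (𝓝 (θ (y * Complex.I))) := by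
          refine (hc (y * Complex.I) (by simp)).tendsto.comp ?_
          refine tendsto_nhdsWithin_iff.mpr ⟨?_, ?_⟩
          · have : Continuous fun x : ℝ => (x : ℂ) + y * Complex.I := by fun_prop
            exact (this.tendsto' 0 _ (by simp)).mono_left nhdsWithin_le_nhds
          · filter_upwards [self_mem_nhdsWithin] with x hx
            have hx' : 0 < x := hx
            simpa using hx'.le
        simpa using (h2.sub_const (θ (y * Complex.I))).mul_const (F y)
    have h2 := (ENNReal.Tendsto.const_mul (a := ENNReal.ofReal M) hf.tendsto
      (Or.inr ENNReal.ofReal_ne_top)).add h1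
    rw [mul_zero, zero_add] at h2
    refine tendsto_of_tendsto_of_tendsto_of_le_of_le' tendsto_const_nhds h2
      (Eventually.of_forall fun _ => zero_le) ?_
    filter_upwards [self_mem_nhdsWithin] with x hx
    have hx' : 0 < x := hx
    have hm := (memLp_slice hf.toIsHardy hx).1
    have hFm := Lp.aestronglyMeasurable F
    have h0 := hcl 0 le_rfl
    simp only [Complex.ofReal_zero, zero_add] at h0
    have h3 := eLpNorm_add_le (p := 2) ((hcl x hx'.le).aestronglyMeasurable.mul (hm.sub hFm))
      (((hcl x hx'.le).sub h0).aestronglyMeasurable.mul hFm) (by norm_num)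
    refine le_trans (le_of_eq (eLpNorm_congr_ae ?_)) (h3.trans (add_le_add ?_ le_rfl))
    · filter_upwards [hH] with y hy
      simp only [hy, slice, Pi.add_apply, Pi.mul_apply, Pi.sub_apply]
      ring
    · refine eLpNorm_le_mul_eLpNorm_of_ae_le_mul (Eventually.of_forall fun y => ?_) 2
      rw [Pi.mul_apply, norm_mul]
      exact mul_le_mul_of_nonneg_right (hM _ (by simpa using hx'.le)) (norm_nonneg _)

/-! ### The Poisson kernel, unnormalised with mass `π` -/

theorem poisson_eq (x u : ℝ) (hx : 0 < x) : x / (x ^ 2 + u ^ 2) = x⁻¹ * (1 + (u / x) ^ 2)⁻¹ := by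
  field_simp

theorem integrable_poisson {x : ℝ} (hx : 0 < x) : Integrable fun u : ℝ => x / (x ^ 2 + u ^ 2) := by
  simp_rw [poisson_eq x _ hx]
  exact (integrable_inv_one_add_sq.comp_div hx.ne').const_mul _

theorem integral_poisson {x : ℝ} (hx : 0 < x) : ∫ u : ℝ, x / (x ^ 2 + u ^ 2) = Real.pi := by
  simp_rw [poisson_eq x _ hx]
  rw [integral_const_mul, Measure.integral_comp_div (fun u : ℝ => (1 + u ^ 2)⁻¹),
    integral_univ_inv_one_add_sq, abs_of_pos hx, smul_eq_mul, inv_mul_cancel_left₀ hx.ne']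

/-- The substitution `η = y - xv` turns the integral into `∫ φ(y - xv)/(1 + v²) dv`, where dominated
convergence applies. -/
theorem tendsto_poisson {φ : ℝ → ℝ} (hφ : Continuous φ) (hs : HasCompactSupport φ) (y : ℝ) :
    Tendsto (fun x : ℝ => ∫ η, φ η * (x / (x ^ 2 + (y - η) ^ 2))) (𝓝[>] 0)
      (𝓝 (Real.pi * φ y)) := by
  obtain ⟨M, hM⟩ := hs.exists_bound_of_continuous hφ
  have h1 : ∀ x : ℝ, 0 < x → ∫ η, φ η * (x / (x ^ 2 + (y - η) ^ 2)) =
      ∫ v, φ (y - x * v) * (1 + v ^ 2)⁻¹ := by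
    intro x hx
    have e1 := integral_sub_left_eq_self (fun η => φ η * (x / (x ^ 2 + (y - η) ^ 2))) volume y
    have e2 := Measure.integral_comp_mul_left
      (fun u => φ (y - u) * (x / (x ^ 2 + (y - (y - u)) ^ 2))) x
    rw [e1, abs_of_pos (inv_pos.mpr hx), eq_inv_smul_iff₀ hx.ne', ← integral_smul] at e2
    rw [← e2]
    congr 1; ext v
    rw [smul_eq_mul]
    field_simp
    ring
  have h2 : Tendsto (fun x : ℝ => ∫ v, φ (y - x * v) * (1 + v ^ 2)⁻¹) (𝓝[>] 0)
      (𝓝 (∫ v : ℝ, φ y * (1 + v ^ 2)⁻¹)) := by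
    refine tendsto_integral_filter_of_dominated_convergence (fun v => M * (1 + v ^ 2)⁻¹)
      (Eventually.of_forall fun x => ?_) (Eventually.of_forall fun x =>
        Eventually.of_forall fun v => ?_) (integrable_inv_one_add_sq.const_mul M)
      (Eventually.of_forall fun v => ?_)
    · refine Continuous.aestronglyMeasurable ?_
      exact (hφ.comp (by fun_prop)).mul (Continuous.inv₀ (by fun_prop) fun v => by positivity)
    · rw [norm_mul, Real.norm_of_nonneg (by positivity : (0:ℝ) ≤ (1 + v ^ 2)⁻¹)]
      exact mul_le_mul_of_nonneg_right (hM _) (by positivity)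
    · refine Tendsto.mul_const _ ?_
      have : Continuous fun x : ℝ => φ (y - x * v) := hφ.comp (by fun_prop)
      exact (this.tendsto' 0 _ (by simp)).mono_left nhdsWithin_le_nhds
  rw [integral_const_mul, integral_univ_inv_one_add_sq, mul_comm] at h2
  refine h2.congr' ?_
  filter_upwards [self_mem_nhdsWithin] with x hx using (h1 x hx).symm

/-- Since `1 + y² ≤ 1 + 2R² + 2(y-η)²`, the last term is absorbed by the denominator. This yields
majorants decaying like `1/(1+y²)`, whose product with an `L²` function is integrable. -/
theorem one_add_sq_mul_poisson_le {x y η R : ℝ} (hx : 0 < x) (hη : |η| ≤ R) :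
    (1 + y ^ 2) * (x / (x ^ 2 + (y - η) ^ 2)) ≤
      (1 + 2 * R ^ 2) * (x / (x ^ 2 + (y - η) ^ 2)) + 2 * x := by
  have h1 : η ^ 2 ≤ R ^ 2 := by
    rw [← sq_abs]; exact pow_le_pow_left₀ (abs_nonneg _) hη 2
  have h2 : 1 + y ^ 2 ≤ (1 + 2 * R ^ 2) + 2 * (y - η) ^ 2 := by
    nlinarith [sq_nonneg (y - 2 * η)]
  have h3 : (y - η) ^ 2 * (x / (x ^ 2 + (y - η) ^ 2)) ≤ x := by
    rw [mul_div_assoc', div_le_iff₀ (by positivity)]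
    nlinarith [pow_pos hx 3]
  have h4 : 0 ≤ x / (x ^ 2 + (y - η) ^ 2) := by positivity
  nlinarith [mul_le_mul_of_nonneg_right h2 h4]

theorem continuous_poisson {x : ℝ} (hx : 0 < x) :
    Continuous fun p : ℝ × ℝ => x / (x ^ 2 + (p.2 - p.1) ^ 2) :=
  Continuous.div continuous_const (by fun_prop) fun p => by positivity

theorem memLp_inv_one_add_sq : MemLp (fun y : ℝ => (((1 + y ^ 2)⁻¹ : ℝ) : ℂ)) 2 volume := by
  have hc : Continuous fun y : ℝ => (((1 + y ^ 2)⁻¹ : ℝ) : ℂ) :=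
    Complex.continuous_ofReal.comp (Continuous.inv₀ (by fun_prop) fun v => by positivity)
  rw [memLp_two_iff_integrable_sq_norm hc.aestronglyMeasurable]
  refine integrable_inv_one_add_sq.mono' (hc.norm.pow 2).aestronglyMeasurable
    (Eventually.of_forall fun y => ?_)
  rw [Complex.norm_real, Real.norm_of_nonneg (by positivity), Real.norm_of_nonneg (by positivity)]
  have h1 : (1 + y ^ 2)⁻¹ ≤ 1 := inv_le_one_of_one_le₀ (by nlinarith)
  have h2 : 0 ≤ (1 + y ^ 2)⁻¹ := by positivity
  nlinarith

/-- A function in `L²(ℝ)` all of whose Poisson integrals vanish is zero. -/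
theorem ae_eq_zero_of_poisson {G : ℝ → ℂ} (hG : MemLp G 2 volume)
    (h : ∀ x : ℝ, 0 < x → ∀ η : ℝ,
      ∫ y, ((x / (x ^ 2 + (y - η) ^ 2) : ℝ) : ℂ) * G y = 0) : ∀ᵐ y, G y = 0 := by
  refine ae_eq_zero_of_integral_contDiff_smul_eq_zero (hG.locallyIntegrable (by norm_num))
    fun φ hφ hs => ?_
  have hφc := hφ.continuous
  obtain ⟨M, hM⟩ := hs.exists_bound_of_continuous hφc
  have hM0 : 0 ≤ M := (norm_nonneg _).trans (hM 0)
  obtain ⟨R, hR⟩ := hs.isCompact.isBounded.exists_norm_le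
  have hφR : ∀ η, φ η ≠ 0 → |η| ≤ R := fun η hη => hR η (subset_tsupport _ hη)
  have hφi : Integrable φ := hφc.integrable_of_hasCompactSupport hs
  have hGi : Integrable fun y => (((1 + y ^ 2)⁻¹ : ℝ) : ℂ) * G y :=
    memLp_inv_one_add_sq.integrable_mul hG
  -- By Fubini, pairing `G` with the Poisson integral `q x` of the test function amounts to pairing
  -- `φ` with the Poisson integral of `G`, which is zero. As `x → 0`, `q x` tends to `πφ`.
  set q : ℝ → ℝ → ℝ := fun x y => ∫ η, φ η * (x / (x ^ 2 + (y - η) ^ 2)) with hq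
  have hp0 : ∀ {x : ℝ}, 0 < x → ∀ u : ℝ, 0 ≤ x / (x ^ 2 + u ^ 2) := fun hx u => by positivity
  have hzero : ∀ x : ℝ, 0 < x → ∫ y, (q x y : ℂ) * G y = 0 := by
    intro x hx
    have hint : Integrable (fun p : ℝ × ℝ =>
        (φ p.1 : ℂ) * (((x / (x ^ 2 + (p.2 - p.1) ^ 2) : ℝ) : ℂ) * G p.2))
        (volume.prod volume) := by
      have hb := (hφi.ofReal (𝕜 := ℂ)).mul_prod
        (hGi.const_mul (((1 + 2 * R ^ 2) * x⁻¹ + 2 * x : ℝ) : ℂ))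
      refine hb.norm.mono' ?_ (Eventually.of_forall fun p => ?_)
      · refine (Complex.continuous_ofReal.comp (hφc.comp continuous_fst)).aestronglyMeasurable.mul
          ((Complex.continuous_ofReal.comp (continuous_poisson hx)).aestronglyMeasurable.mul
            hG.1.comp_snd)
      · simp only [norm_mul, RCLike.norm_ofReal, Complex.norm_real]
        by_cases hη : φ p.1 = 0
        · simp [hη]
        have h1 := one_add_sq_mul_poisson_le (y := p.2) hx (hφR _ hη)
        have h2 : x / (x ^ 2 + (p.2 - p.1) ^ 2) ≤ x⁻¹ := by
          rw [div_le_iff₀ (by positivity)]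
          have : x = x⁻¹ * x ^ 2 := by field_simp
          nlinarith [inv_pos.mpr hx, sq_nonneg (p.2 - p.1),
            mul_nonneg (inv_pos.mpr hx).le (sq_nonneg (p.2 - p.1))]
        have h3 : ‖x / (x ^ 2 + (p.2 - p.1) ^ 2)‖ ≤
            ‖(1 + 2 * R ^ 2) * x⁻¹ + 2 * x‖ * ‖(1 + p.2 ^ 2)⁻¹‖ := by
          rw [Real.norm_of_nonneg (hp0 hx _), Real.norm_of_nonneg (by positivity),
            Real.norm_of_nonneg (by positivity), ← div_eq_mul_inv, le_div_iff₀ (by positivity),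
            mul_comm]
          refine h1.trans ?_
          gcongr
        rw [← mul_assoc ‖(1 + 2 * R ^ 2) * x⁻¹ + 2 * x‖]
        gcongr
        exact (Real.norm_eq_abs _).le
    have hsw := integral_integral_swap (f := fun η y =>
      (φ η : ℂ) * (((x / (x ^ 2 + (y - η) ^ 2) : ℝ) : ℂ) * G y)) hint
    simp only [integral_const_mul] at hsw
    simp only [h x hx, mul_zero, integral_zero] at hsw
    rw [hsw]
    congr 1; ext y
    simp only [hq, ← integral_complex_ofReal, ← integral_mul_const]
    congr 1; ext η
    push_cast; ring
  -- A majorant independent of `x`: the kernel term integrates to `π` against the bound `M` of `φ`,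
  -- and the term `2x` is at most `2`.
  have hbd : ∀ x : ℝ, x ∈ Ioc (0 : ℝ) 1 → ∀ y, |q x y| ≤
      (M * (1 + 2 * R ^ 2) * Real.pi + 2 * ∫ η, ‖φ η‖) * (1 + y ^ 2)⁻¹ := by
    intro x hx y
    have hpi : Integrable fun η => x / (x ^ 2 + (y - η) ^ 2) := (integrable_poisson hx.1).comp_sub_left y
    have hpe : ∫ η, x / (x ^ 2 + (y - η) ^ 2) = Real.pi := by
      rw [integral_sub_left_eq_self (fun u => x / (x ^ 2 + u ^ 2)), integral_poisson hx.1]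
    rw [← div_eq_mul_inv, le_div_iff₀ (by positivity), ← Real.norm_eq_abs]
    have h1 : ‖q x y‖ ≤ ∫ η, ‖φ η‖ * (x / (x ^ 2 + (y - η) ^ 2)) := by
      refine (norm_integral_le_integral_norm _).trans_eq ?_
      congr 1; ext η
      rw [norm_mul, Real.norm_of_nonneg (hp0 hx.1 _)]
    refine (mul_le_mul_of_nonneg_right h1 (by positivity)).trans ?_
    rw [← integral_mul_const, ← integral_const_mul, ← hpe, ← integral_const_mul, ← integral_add
      (hpi.const_mul _) (hφi.norm.const_mul _)]
    refine integral_mono_of_nonneg (Eventually.of_forall fun η => ?_)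
      ((hpi.const_mul _).add (hφi.norm.const_mul _)) (Eventually.of_forall fun η => ?_)
    · have := hp0 hx.1 (y - η)
      simp only [Pi.zero_apply]
      positivity
    · have hp := hp0 hx.1 (y - η)
      by_cases hη : φ η = 0
      · simp only [hη, norm_zero, zero_mul, mul_zero, add_zero]
        positivity
      have h2 := one_add_sq_mul_poisson_le (y := y) hx.1 (hφR _ hη)
      have h3 := mul_le_mul_of_nonneg_left h2 (norm_nonneg (φ η))
      have h4 := mul_le_mul_of_nonneg_right (hM η)
        (by positivity : 0 ≤ (1 + 2 * R ^ 2) * (x / (x ^ 2 + (y - η) ^ 2)))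
      have h5 := mul_le_mul_of_nonneg_left hx.2 (norm_nonneg (φ η))
      simp only
      nlinarith
  have hlim : Tendsto (fun x : ℝ => ∫ y, (q x y : ℂ) * G y) (𝓝[>] 0)
      (𝓝 (∫ y, ((Real.pi * φ y : ℝ) : ℂ) * G y)) := by
    refine tendsto_integral_filter_of_dominated_convergence
      (fun y => (M * (1 + 2 * R ^ 2) * Real.pi + 2 * ∫ η, ‖φ η‖) *
        ‖(((1 + y ^ 2)⁻¹ : ℝ) : ℂ) * G y‖) ?_ ?_ (hGi.norm.const_mul _) ?_
    · filter_upwards [self_mem_nhdsWithin] with x hx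
      refine AEStronglyMeasurable.mul ?_ hG.1
      refine Complex.continuous_ofReal.comp_aestronglyMeasurable ?_
      have : AEStronglyMeasurable (fun p : ℝ × ℝ => φ p.2 * (x / (x ^ 2 + (p.1 - p.2) ^ 2)))
          (volume.prod volume) :=
        ((hφc.comp continuous_snd).mul
          ((continuous_poisson hx).comp continuous_swap)).aestronglyMeasurable
      exact this.integral_prod_right'
    · filter_upwards [Ioc_mem_nhdsGT zero_lt_one] with x hx
      refine Eventually.of_forall fun y => ?_
      rw [norm_mul, norm_mul, ← mul_assoc, Complex.norm_real, Complex.norm_real,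
        Real.norm_eq_abs, Real.norm_of_nonneg (by positivity : 0 ≤ (1 + y ^ 2)⁻¹)]
      exact mul_le_mul_of_nonneg_right (hbd x hx y) (norm_nonneg _)
    · refine Eventually.of_forall fun y => Tendsto.mul_const _ ?_
      exact (Complex.continuous_ofReal.tendsto _).comp (tendsto_poisson hφc hs y)
  have h0 : ∫ y, ((Real.pi * φ y : ℝ) : ℂ) * G y = 0 := by
    refine tendsto_nhds_unique (hlim.congr' ?_) tendsto_const_nhds
    filter_upwards [self_mem_nhdsWithin] with x hx using hzero x hx
  simp only [Complex.ofReal_mul, mul_assoc, integral_const_mul, mul_eq_zero,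
    Complex.ofReal_eq_zero, Real.pi_ne_zero, false_or] at h0
  simpa using h0

/-! ### Cauchy's theorem on vertical lines and on the boundary -/

theorem integrable_mul_of_memLp {f g : ℝ → ℂ} (hf : MemLp f 2 volume) (hg : MemLp g 2 volume) :
    Integrable fun y => f y * g y :=
  hf.integrable_mul hg

theorem IsHardy.norm_le {f : ℂ → ℂ} (hf : IsHardy f) {x₀ : ℝ} (hx₀ : 0 < x₀) :
    ∃ D : ℝ, 0 ≤ D ∧ ∀ w : ℂ, x₀ ≤ w.re → ‖f w‖ ≤ D := by
  obtain ⟨C, hC⟩ := hf.bounded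
  refine ⟨C / √(x₀ / 2), by positivity, fun w hw => ?_⟩
  have hw0 : 0 < w.re := hx₀.trans_le hw
  have h := hf.enorm_sq_le hC hw0
  rw [← ofReal_norm, ← ENNReal.ofReal_pow (norm_nonneg _),
    ← ENNReal.ofReal_mul (by positivity), ← ENNReal.coe_pow, ENNReal.ofReal_le_coe] at h
  rw [NNReal.coe_pow] at h
  rw [le_div_iff₀ (by positivity)]
  refine abs_le_of_sq_le_sq' ?_ (NNReal.coe_nonneg C) |>.2
  rw [mul_pow, Real.sq_sqrt (by positivity)]
  have h1 := mul_le_mul_of_nonneg_right hw (sq_nonneg ‖f w‖)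
  linarith

theorem memLp_inv_add_slice {a : ℂ} (ha : 0 < a.re) {x : ℝ} (hx : 0 ≤ x) :
    MemLp (fun y : ℝ => (a + (x + y * Complex.I))⁻¹) 2 volume := by
  have := memLp_inv_add_mul_I (a := a + x) (by simpa using by linarith)
  simpa only [add_assoc] using this

theorem norm_inv_add_mul_I_le_im (a : ℂ) (x : ℝ) {R : ℝ} (h : R + a.im ≠ 0) :
    ‖(a + (x + R * Complex.I))⁻¹‖ ≤ |R + a.im|⁻¹ := by
  rw [norm_inv]
  refine inv_anti₀ (abs_pos.mpr h) ?_
  have := Complex.abs_im_le_norm (a + (x + R * Complex.I))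
  simpa [add_comm] using this

/-- Cauchy's theorem on the rectangle `[x₁, x₂] × [-R, R]`: the horizontal sides vanish as `R → ∞`,
because `f` is bounded on `Re s ≥ x₁` and the kernel decays. -/
theorem IsHardy.integral_slice_mul_inv_eq {f : ℂ → ℂ} (hf : IsHardy f) {a : ℂ} (ha : 0 < a.re)
    {x₁ x₂ : ℝ} (hx₁ : 0 < x₁) (hx : x₁ ≤ x₂) :
    ∫ y, slice f x₁ y * (a + (x₁ + y * Complex.I))⁻¹ =
      ∫ y, slice f x₂ y * (a + (x₂ + y * Complex.I))⁻¹ := by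
  set φ : ℂ → ℂ := fun s => f s * (a + s)⁻¹ with hφ
  obtain ⟨D, hD0, hD⟩ := hf.norm_le hx₁
  have hx₂ := hx₁.trans_le hx
  have hφd : DifferentiableOn ℂ φ rightHalfPlane :=
    hf.differentiableOn.mul (DifferentiableOn.inv (by fun_prop)
      fun s hs => add_ne_zero_of_re_pos ha (le_of_lt hs))
  have hrect : ∀ R : ℝ, (∫ x in x₁..x₂, φ (x + ((-R : ℝ) : ℂ) * Complex.I)) -
      (∫ x in x₁..x₂, φ (x + (R : ℂ) * Complex.I)) +
      Complex.I • (∫ y in (-R)..R, φ (x₂ + y * Complex.I)) -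
      Complex.I • (∫ y in (-R)..R, φ (x₁ + y * Complex.I)) = 0 := by
    intro R
    have := Complex.integral_boundary_rect_eq_zero_of_differentiableOn φ
      ⟨x₁, -R⟩ ⟨x₂, R⟩ (hφd.mono fun s hs => ?_)
    · exact this
    · have h1 := hs.1
      simp only [uIcc_of_le hx, mem_preimage, mem_Icc] at h1
      exact hx₁.trans_le h1.1
  -- A general filter serves both the upper side (`R → +∞`) and the lower side (`R → -∞`).
  have hhor : ∀ l : Filter ℝ, Tendsto (fun R : ℝ => |R + a.im|) l atTop →
      Tendsto (fun R : ℝ => ∫ x in x₁..x₂, φ (x + (R : ℂ) * Complex.I)) l (𝓝 0) := by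
    intro l hl
    have h1 : Tendsto (fun R : ℝ => D * |R + a.im|⁻¹ * |x₂ - x₁|) l (𝓝 0) := by
      simpa using (hl.inv_tendsto_atTop.const_mul D).mul_const |x₂ - x₁|
    refine squeeze_zero_norm' ?_ h1
    filter_upwards [hl.eventually_gt_atTop 0] with R hR
    refine intervalIntegral.norm_integral_le_of_norm_le_const fun x hx' => ?_
    rw [uIoc_of_le hx] at hx'
    rw [hφ, norm_mul]
    exact mul_le_mul (hD _ (by simpa using hx'.1.le))
      (norm_inv_add_mul_I_le_im a x (abs_pos.mp hR)) (norm_nonneg _) hD0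
  have hvert : ∀ x : ℝ, 0 < x → Tendsto (fun R : ℝ => ∫ y in (-R)..R, φ (x + y * Complex.I)) atTop
      (𝓝 (∫ y, slice f x y * (a + (x + y * Complex.I))⁻¹)) := fun x hx =>
    intervalIntegral_tendsto_integral
      ((memLp_slice hf hx).integrable_mul (memLp_inv_add_slice ha hx.le))
      tendsto_neg_atTop_atBot tendsto_id
  have hup : Tendsto (fun R : ℝ => |R + a.im|) atTop atTop :=
    tendsto_abs_atTop_atTop.comp (tendsto_atTop_add_const_right _ _ tendsto_id)
  have hdown : Tendsto (fun R : ℝ => |R + a.im|) atBot atTop :=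
    tendsto_abs_atBot_atTop.comp (tendsto_atBot_add_const_right _ _ tendsto_id)
  have hlim := (((hhor _ hdown).comp tendsto_neg_atTop_atBot).sub (hhor _ hup)).add
    ((hvert x₂ hx₂).const_smul Complex.I) |>.sub ((hvert x₁ hx₁).const_smul Complex.I)
  have h0 := tendsto_nhds_unique (hlim.congr hrect) tendsto_const_nhds
  rw [sub_zero, zero_add, sub_eq_zero, smul_right_inj Complex.I_ne_zero] at h0
  exact h0.symm

theorem tendsto_eLpNorm_inv_add_atTop {a : ℂ} (ha : 0 < a.re) :
    Tendsto (fun x : ℝ => eLpNorm (fun y : ℝ => (a + (x + y * Complex.I))⁻¹) 2 volume)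
      atTop (𝓝 0) := by
  refine tendsto_eLpNorm_two_zero_of_dominated (memLp_inv_add_mul_I ha) ?_ ?_ ?_
  · filter_upwards [eventually_ge_atTop 0] with x hx using (memLp_inv_add_slice ha hx).1
  · filter_upwards [eventually_ge_atTop 0] with x hx
    exact Eventually.of_forall fun y => norm_inv_add_le ha hx y
  · refine Eventually.of_forall fun y => ?_
    refine squeeze_zero_norm' ?_ tendsto_inv_atTop_zero
    filter_upwards [eventually_gt_atTop 0] with x hx
    rw [norm_inv]
    refine inv_anti₀ hx ?_
    have := Complex.re_le_norm (a + (x + y * Complex.I))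
    simp at this
    linarith

/-- Cauchy's theorem for boundary functions. -/
theorem HasBoundary.integral_mul_inv_eq_zero {f : ℂ → ℂ} {F : Lp ℂ 2 (volume : Measure ℝ)}
    (hf : HasBoundary f F) {a : ℂ} (ha : 0 < a.re) :
    ∫ y, F y * (a + y * Complex.I)⁻¹ = 0 := by
  -- The line is pushed to `+∞`, where the kernel tends to zero in `L²` while the slices stay
  -- bounded by `‖F‖`.
  have hslice : ∀ b : ℂ, 0 < b.re → ∀ x : ℝ, 0 < x →
      ∫ y, slice f x y * (b + (x + y * Complex.I))⁻¹ = 0 := by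
    intro b hb x hx
    have h1 := ENNReal.Tendsto.const_mul (a := ‖F‖ₑ) (tendsto_eLpNorm_inv_add_atTop hb)
      (Or.inr enorm_ne_top)
    rw [mul_zero] at h1
    rw [← enorm_eq_zero]
    refine le_antisymm (ge_of_tendsto h1 ?_) zero_le
    filter_upwards [eventually_ge_atTop x] with x' hx'
    have hx0 := hx.trans_le hx'
    rw [hf.toIsHardy.integral_slice_mul_inv_eq hb hx hx']
    exact (enorm_integral_mul_le (memLp_slice hf.toIsHardy hx0).1
      (memLp_inv_add_slice hb hx0.le).1).trans (mul_le_mul' (hf.eLpNorm_slice_le hx0) le_rfl)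
  have hk := memLp_inv_add_mul_I ha
  have h2 := ENNReal.Tendsto.mul_const
    (b := eLpNorm (fun y : ℝ => (a + y * Complex.I)⁻¹) 2 volume) hf.tendsto (Or.inr hk.2.ne)
  rw [zero_mul] at h2
  rw [← enorm_eq_zero]
  refine le_antisymm (ge_of_tendsto h2 ?_) zero_le
  filter_upwards [Ioo_mem_nhdsGT ha] with x hx
  have hm := memLp_slice hf.toIsHardy hx.1
  -- With parameter `a - x`, allowed for `x < Re a`, the kernel on the line `Re s = x` is exactly
  -- `1/(a+iy)`, so only the slice of `f` varies with `x`.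
  have h3 := hslice (a - x) (by simpa using hx.2) x hx.1
  have e : ∀ y : ℝ, a - x + (x + y * Complex.I) = a + y * Complex.I := fun y => by ring
  simp only [e] at h3
  have h4 : ∫ y, (slice f x y - F y) * (a + y * Complex.I)⁻¹ =
      -∫ y, F y * (a + y * Complex.I)⁻¹ := by
    simp only [sub_mul]
    rw [integral_sub (integrable_mul_of_memLp hm hk) (integrable_mul_of_memLp (Lp.memLp F) hk), h3, zero_sub]
  rw [← enorm_neg, ← h4]
  exact enorm_integral_mul_le (hm.1.sub (Lp.aestronglyMeasurable F)) hk.1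

/-! ### Recognising boundary functions by the Cauchy kernels -/

theorem inner_eq_integral (F G : Lp ℂ 2 (volume : Measure ℝ)) :
    inner ℂ F G = ∫ y, G y * conj (F y) := by
  rw [L2.inner_def]
  rfl

/-- A function in `L²(ℝ)` orthogonal to the conjugate Cauchy kernels is a boundary function. -/
theorem mem_H2_of_integral_mul_inv_eq_zero (G : Lp ℂ 2 (volume : Measure ℝ))
    (h : ∀ a : ℂ, 0 < a.re → ∫ y, G y * (a + y * Complex.I)⁻¹ = 0) : G ∈ H2 := by
  -- The component `D` orthogonal to `H²` must be shown to vanish. It annihilates the kernels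
  -- because `G` and `P` do, and their conjugates because the kernels lie in `H²`.
  obtain ⟨P, hP, D, hD, hG⟩ := H2.exists_add_mem_mem_orthogonal G
  obtain ⟨p, hp⟩ := hP
  have hDG : D =ᵐ[volume] fun y => G y - P y := by
    have e : D = G - P := by rw [hG]; abel
    rw [e]
    exact Lp.coeFn_sub G P
  have hleft : ∀ a : ℂ, 0 < a.re → ∫ y, D y * (a + y * Complex.I)⁻¹ = 0 := by
    intro a ha
    have hk := memLp_inv_add_mul_I ha
    have h1 : ∫ y, D y * (a + y * Complex.I)⁻¹ =
        ∫ y, (G y * (a + y * Complex.I)⁻¹ - P y * (a + y * Complex.I)⁻¹) := by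
      refine integral_congr_ae ?_
      filter_upwards [hDG] with y hy
      rw [hy, sub_mul]
    rw [h1, integral_sub (integrable_mul_of_memLp (Lp.memLp G) hk) (integrable_mul_of_memLp (Lp.memLp P) hk),
      h a ha, hp.integral_mul_inv_eq_zero ha, sub_zero]
  have hright : ∀ a : ℂ, 0 < a.re → ∫ y, D y * conj (a + y * Complex.I)⁻¹ = 0 := by
    intro a ha
    have h1 := hD _ ⟨_, hasBoundary_inv_add ha⟩
    rw [inner_eq_integral] at h1
    rw [← h1]
    refine integral_congr_ae ?_
    filter_upwards [(memLp_inv_add_mul_I ha).coeFn_toLp] with y hy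
    rw [hy]
  have hD0 : D = 0 := by
    refine (Lp.eq_zero_iff_ae_eq_zero).mpr (ae_eq_zero_of_poisson (Lp.memLp D) fun x hx η => ?_)
    -- For `a = x - iη`, half the sum of the kernel and its conjugate is the Poisson kernel at `(x,
    -- η)`.
    have ha : 0 < ((x : ℂ) - η * Complex.I).re := by simpa using hx
    have hk := memLp_inv_add_mul_I ha
    have e : ∀ y : ℝ, ((x / (x ^ 2 + (y - η) ^ 2) : ℝ) : ℂ) * D y =
        1 / 2 * (D y * ((x : ℂ) - η * Complex.I + y * Complex.I)⁻¹ +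
          D y * conj ((x : ℂ) - η * Complex.I + y * Complex.I)⁻¹) := by
      intro y
      have h1 := add_mul_I_ne_zero ha y
      have h2 : conj ((x : ℂ) - η * Complex.I + y * Complex.I) =
          x + η * Complex.I - y * Complex.I := by simp; ring
      have h3 : (x : ℂ) + η * Complex.I - y * Complex.I ≠ 0 := by
        rw [← h2]; exact (map_ne_zero _).mpr h1
      have h4 : (x : ℂ) ^ 2 + (y - η) ^ 2 =
          (x - η * Complex.I + y * Complex.I) * (x + η * Complex.I - y * Complex.I) := by
        ring_nf; rw [Complex.I_sq]; ring
      rw [map_inv₀, h2]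
      push_cast
      have h5 : (x : ℂ) = ((x - η * Complex.I + y * Complex.I) +
          (x + η * Complex.I - y * Complex.I)) / 2 := by ring
      rw [h4]
      generalize (x : ℂ) - η * Complex.I + y * Complex.I = A at h1 h5 ⊢
      generalize (x : ℂ) + η * Complex.I - y * Complex.I = B at h3 h5 ⊢
      rw [h5]
      field_simp
      ring
    have hk' : MemLp (fun y : ℝ => conj ((x : ℂ) - η * Complex.I + y * Complex.I)⁻¹) 2 volume :=
      hk.star
    simp only [e]
    rw [integral_const_mul, integral_add (integrable_mul_of_memLp (Lp.memLp D) hk)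
      (integrable_mul_of_memLp (Lp.memLp D) hk'), hleft _ ha, hright _ ha, add_zero, mul_zero]
  rw [hG, hD0, add_zero]
  exact ⟨p, hp⟩

/-! ### Integrals against `e^{ily} ψ` and their derivative in `l` -/

theorem memLp_mul_of_norm_le {θ ψ : ℝ → ℂ} {p : ℝ≥0∞} (hψ : MemLp ψ p volume)
    (hθ : Continuous θ) {M : ℝ} (hM : ∀ y, ‖θ y‖ ≤ M) : MemLp (fun y => θ y * ψ y) p volume :=
  hψ.of_le_mul (hθ.aestronglyMeasurable.mul hψ.1) (c := M) (Eventually.of_forall fun y => by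
    rw [norm_mul]; exact mul_le_mul_of_nonneg_right (hM y) (norm_nonneg _))

theorem integral_mul_eq_zero_of_linear_combination {F ψ ψ₁ ψ₂ : ℝ → ℂ} (hF : MemLp F 2 volume)
    (h₁ : MemLp ψ₁ 2 volume) (h₂ : MemLp ψ₂ 2 volume) (c₁ c₂ : ℂ)
    (e : ∀ y, ψ y = c₁ * ψ₁ y + c₂ * ψ₂ y) (z₁ : ∫ y, F y * ψ₁ y = 0)
    (z₂ : ∫ y, F y * ψ₂ y = 0) : ∫ y, F y * ψ y = 0 := by
  have h : ∀ y, F y * ψ y = c₁ * (F y * ψ₁ y) + c₂ * (F y * ψ₂ y) := fun y => by rw [e]; ring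
  simp only [h]
  rw [integral_add ((integrable_mul_of_memLp hF h₁).const_mul c₁)
    ((integrable_mul_of_memLp hF h₂).const_mul c₂), integral_const_mul, integral_const_mul, z₁, z₂]
  simp

theorem norm_exp_mul_I (l y : ℝ) : ‖Complex.exp (l * (y * Complex.I))‖ = 1 := by
  rw [Complex.norm_exp]; simp

theorem memLp_exp_mul_I {ψ : ℝ → ℂ} (hψ : MemLp ψ 2 volume) (l : ℝ) :
    MemLp (fun y : ℝ => Complex.exp (l * (y * Complex.I)) * ψ y) 2 volume :=
  memLp_mul_of_norm_le hψ (by fun_prop) fun y => (norm_exp_mul_I l y).le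

theorem hasDerivAt_integral_mul_exp {F ψ : ℝ → ℂ} (hF : MemLp F 2 volume)
    (h₀ : MemLp ψ 2 volume) (h₁ : MemLp (fun y : ℝ => y * Complex.I * ψ y) 2 volume) (l : ℝ) :
    HasDerivAt (fun l : ℝ => ∫ y, F y * (Complex.exp (l * (y * Complex.I)) * ψ y))
      (∫ y, F y * (Complex.exp (l * (y * Complex.I)) * (y * Complex.I * ψ y))) l := by
  refine (hasDerivAt_integral_of_dominated_loc_of_deriv_le (s := univ) (𝕜 := ℝ)
    (F := fun l y => F y * (Complex.exp (l * (y * Complex.I)) * ψ y))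
    (F' := fun l y => F y * (Complex.exp (l * (y * Complex.I)) * (y * Complex.I * ψ y)))
    (bound := fun y => ‖F y * (y * Complex.I * ψ y)‖) univ_mem
    (Eventually.of_forall fun l => (integrable_mul_of_memLp hF (memLp_exp_mul_I h₀ l)).1)
    (integrable_mul_of_memLp hF (memLp_exp_mul_I h₀ l))
    (integrable_mul_of_memLp hF (memLp_exp_mul_I h₁ l)).1 ?_
    (integrable_mul_of_memLp hF h₁).norm ?_).2
  · refine Eventually.of_forall fun y l _ => le_of_eq ?_
    simp only [norm_mul, norm_exp_mul_I, one_mul]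
  · refine Eventually.of_forall fun y l _ => ?_
    have h1 : HasDerivAt (fun l : ℝ => (l : ℂ) * (y * Complex.I)) (1 * (y * Complex.I)) l :=
      (Complex.ofRealCLM.hasDerivAt (x := l)).mul_const _
    exact (((h1.cexp).mul_const (ψ y)).const_mul (F y)).congr_deriv (by ring)

/-- A function vanishing on `[0, δ]` has zero derivative within that interval, endpoints included;
`δ > 0` makes this derivative unique. -/
theorem integral_mul_exp_mul_eq_zero {F ψ : ℝ → ℂ} (hF : MemLp F 2 volume)
    (h₀ : MemLp ψ 2 volume) (h₁ : MemLp (fun y : ℝ => y * Complex.I * ψ y) 2 volume) {δ : ℝ}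
    (hδ : 0 < δ) (hz : ∀ l ∈ Icc (0 : ℝ) δ,
      ∫ y, F y * (Complex.exp (l * (y * Complex.I)) * ψ y) = 0) {l : ℝ} (hl : l ∈ Icc 0 δ) :
    ∫ y, F y * (Complex.exp (l * (y * Complex.I)) * (y * Complex.I * ψ y)) = 0 := by
  have hd := (hasDerivAt_integral_mul_exp hF h₀ h₁ l).hasDerivWithinAt (s := Icc 0 δ)
  have h0 : HasDerivWithinAt (fun l : ℝ =>
      ∫ y, F y * (Complex.exp (l * (y * Complex.I)) * ψ y)) 0 (Icc 0 δ) l :=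
    (hasDerivWithinAt_const l (Icc 0 δ) (0 : ℂ)).congr hz (hz l hl)
  exact (uniqueDiffOn_Icc hδ l hl).eq_deriv _ hd h0

theorem one_sub_mul_I_ne_zero (y : ℝ) : (1 : ℂ) - y * Complex.I ≠ 0 := by
  intro h
  have := congrArg Complex.re h
  simp at this

theorem continuous_inv_one_sub_mul_I : Continuous fun y : ℝ => ((1 : ℂ) - y * Complex.I)⁻¹ :=
  Continuous.inv₀ (by fun_prop) one_sub_mul_I_ne_zero

theorem conj_one_add_mul_I (y : ℝ) : conj (1 + y * Complex.I) = 1 - y * Complex.I := by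
  simp [sub_eq_add_neg]

theorem norm_inv_one_sub_mul_I_le (y : ℝ) : ‖((1 : ℂ) - y * Complex.I)⁻¹‖ ≤ 1 := by
  rw [norm_inv]
  refine inv_le_one_of_one_le₀ ?_
  simpa using Complex.re_le_norm ((1 : ℂ) - y * Complex.I)

theorem memLp_inv_one_sub_pow (j : ℕ) :
    MemLp (fun y : ℝ => ((1 : ℂ) - y * Complex.I)⁻¹ ^ (j + 1)) 2 volume := by
  have h1 : MemLp (fun y : ℝ => ((1 : ℂ) - y * Complex.I)⁻¹) 2 volume := by
    have := (memLp_inv_add_mul_I (a := 1) (by simp)).star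
    refine this.ae_eq (Eventually.of_forall fun y => ?_)
    simp [sub_eq_add_neg]
  simp only [pow_succ]
  refine memLp_mul_of_norm_le h1 (continuous_inv_one_sub_mul_I.pow j) (M := 1) fun y => ?_
  rw [norm_pow]
  exact pow_le_one₀ (norm_nonneg _) (norm_inv_one_sub_mul_I_le y)

theorem norm_one_add_div_one_sub (y : ℝ) :
    ‖((1 : ℂ) + y * Complex.I) / (1 - y * Complex.I)‖ = 1 := by
  rw [norm_div, ← conj_one_add_mul_I, RCLike.norm_conj, div_self]
  exact norm_ne_zero_iff.mpr (add_mul_I_ne_zero (by simp) y)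

theorem memLp_one_add_div_one_sub_pow {ψ : ℝ → ℂ} (hψ : MemLp ψ 2 volume) (m : ℕ) :
    MemLp (fun y : ℝ => (((1 : ℂ) + y * Complex.I) / (1 - y * Complex.I)) ^ m * ψ y) 2 volume := by
  refine memLp_mul_of_norm_le hψ (M := 1) ?_ fun y => ?_
  · exact (Continuous.div (by fun_prop) (by fun_prop) one_sub_mul_I_ne_zero).pow m
  · rw [norm_pow, norm_one_add_div_one_sub, one_pow]

/-! ### Consequences of annihilating all generators -/

section Annihilator

variable {F : ℝ → ℂ} {δ : ℝ}

/-- Differentiation in `l` inserts `iy`, and `iy u^(m+2) = u^(m+2) - u^(m+1)` with `u = 1/(1-iy)`,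
so each derivative lowers the exponent by one. The descent stops at `u`, the last power in `L²`. -/
theorem integral_exp_inv_pow_eq_zero (hF : MemLp F 2 volume) (hδ : 0 < δ) (m : ℕ)
    (h : ∀ l ∈ Icc (0 : ℝ) δ, ∫ y, F y * (Complex.exp (l * (y * Complex.I)) *
      ((1 : ℂ) - y * Complex.I)⁻¹ ^ (m + 1)) = 0) :
    ∀ j ≤ m, ∀ l ∈ Icc (0 : ℝ) δ, ∫ y, F y * (Complex.exp (l * (y * Complex.I)) *
      ((1 : ℂ) - y * Complex.I)⁻¹ ^ (j + 1)) = 0 := by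
  induction m with
  | zero =>
    intro j hj
    rwa [Nat.le_zero.mp hj]
  | succ m ih =>
    intro j hj
    rcases Nat.le_succ_iff.mp hj with hj | rfl
    · have e : ∀ y : ℝ, y * Complex.I * ((1 : ℂ) - y * Complex.I)⁻¹ ^ (m + 1 + 1) =
          ((1 : ℂ) - y * Complex.I)⁻¹ ^ (m + 1 + 1) - ((1 : ℂ) - y * Complex.I)⁻¹ ^ (m + 1) := by
        intro y
        have := one_sub_mul_I_ne_zero y
        rw [pow_succ _ (m + 1)]
        field_simp
        ring
      have h₁ : MemLp (fun y : ℝ => y * Complex.I * ((1 : ℂ) - y * Complex.I)⁻¹ ^ (m + 1 + 1))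
          2 volume := by
        simp only [e]
        exact (memLp_inv_one_sub_pow (m + 1)).sub (memLp_inv_one_sub_pow m)
      refine ih (fun l hl => ?_) j hj
      refine integral_mul_eq_zero_of_linear_combination hF
        (memLp_exp_mul_I (memLp_inv_one_sub_pow (m + 1)) l) (memLp_exp_mul_I h₁ l) 1 (-1)
        (fun y => ?_) (h l hl)
        (integral_mul_exp_mul_eq_zero hF (memLp_inv_one_sub_pow (m + 1)) h₁ hδ h hl)
      rw [e]; ring
    · exact h

/-- As `iy/(a+iy) = 1 - a/(a+iy)`, the integral `Φ(l)` against `e^{ily} u/(a+iy)` satisfies `Φ' =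
-aΦ`; also `Φ(0) = 0` by partial fractions. The extra factor `u = 1/(1-iy)` keeps the kernel in `L²`
after multiplication by `iy`, and partial fractions remove it at the end. -/
theorem integral_exp_inv_add_eq_zero (hF : MemLp F 2 volume) {a : ℂ} (ha : 0 < a.re)
    (hFa : ∫ y, F y * (a + y * Complex.I)⁻¹ = 0)
    (h : ∀ l ∈ Icc (0 : ℝ) δ, ∫ y, F y * (Complex.exp (l * (y * Complex.I)) *
      ((1 : ℂ) - y * Complex.I)⁻¹) = 0) {l : ℝ} (hl : l ∈ Icc (0 : ℝ) δ) :
    ∫ y, F y * (Complex.exp (l * (y * Complex.I)) * (a + y * Complex.I)⁻¹) = 0 := by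
  have hk := memLp_inv_add_mul_I ha
  have hu : MemLp (fun y : ℝ => ((1 : ℂ) - y * Complex.I)⁻¹) 2 volume := by
    simpa using memLp_inv_one_sub_pow 0
  have hψ : MemLp (fun y : ℝ => ((1 : ℂ) - y * Complex.I)⁻¹ * (a + y * Complex.I)⁻¹) 2 volume :=
    memLp_mul_of_norm_le hk continuous_inv_one_sub_mul_I norm_inv_one_sub_mul_I_le
  have e : ∀ y : ℝ, y * Complex.I * (((1 : ℂ) - y * Complex.I)⁻¹ * (a + y * Complex.I)⁻¹) =
      ((1 : ℂ) - y * Complex.I)⁻¹ -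
        a * (((1 : ℂ) - y * Complex.I)⁻¹ * (a + y * Complex.I)⁻¹) := by
    intro y
    have h1 := one_sub_mul_I_ne_zero y
    have h2 := add_mul_I_ne_zero ha y
    field_simp
    ring
  have hψ₁ : MemLp (fun y : ℝ =>
      y * Complex.I * (((1 : ℂ) - y * Complex.I)⁻¹ * (a + y * Complex.I)⁻¹)) 2 volume := by
    simp only [e]
    exact hu.sub (hψ.const_mul a)
  have ha1 : 1 + a ≠ 0 := add_ne_zero_of_re_pos (by simp) ha.le
  have ek : ∀ y : ℝ, (1 + a) * (((1 : ℂ) - y * Complex.I)⁻¹ * (a + y * Complex.I)⁻¹) =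
      (a + y * Complex.I)⁻¹ + ((1 : ℂ) - y * Complex.I)⁻¹ := by
    intro y
    have h1 := one_sub_mul_I_ne_zero y
    have h2 := add_mul_I_ne_zero ha y
    field_simp
    ring
  set Φ : ℝ → ℂ := fun l => ∫ y, F y * (Complex.exp (l * (y * Complex.I)) *
    (((1 : ℂ) - y * Complex.I)⁻¹ * (a + y * Complex.I)⁻¹)) with hΦ
  have hΦ0 : Φ 0 = 0 := by
    refine integral_mul_eq_zero_of_linear_combination hF hk hu (1 + a)⁻¹ (1 + a)⁻¹
      (fun y => ?_) hFa ?_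
    · rw [← mul_add, ← ek, inv_mul_cancel_left₀ ha1]; simp
    · have hδ : (0 : ℝ) ∈ Icc 0 δ := ⟨le_rfl, hl.1.trans hl.2⟩
      simpa using h 0 hδ
  have hΦd : ∀ t ∈ Icc (0 : ℝ) δ, HasDerivAt Φ (-(a * Φ t)) t := by
    intro t ht
    have hd := hasDerivAt_integral_mul_exp hF hψ hψ₁ t
    convert hd using 1
    have e2 : ∀ y : ℝ, F y * (Complex.exp (t * (y * Complex.I)) *
        (y * Complex.I * (((1 : ℂ) - y * Complex.I)⁻¹ * (a + y * Complex.I)⁻¹))) =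
        F y * (Complex.exp (t * (y * Complex.I)) * ((1 : ℂ) - y * Complex.I)⁻¹) -
        a * (F y * (Complex.exp (t * (y * Complex.I)) *
          (((1 : ℂ) - y * Complex.I)⁻¹ * (a + y * Complex.I)⁻¹))) := fun y => by rw [e]; ring
    simp only [e2]
    rw [integral_sub (integrable_mul_of_memLp hF (memLp_exp_mul_I hu t))
      ((integrable_mul_of_memLp hF (memLp_exp_mul_I hψ t)).const_mul a), h t ht,
      integral_const_mul, zero_sub]
  -- Integrating factor for `Φ' = -aΦ`.
  have hχd : ∀ t ∈ Icc (0 : ℝ) δ, HasDerivAt (fun t : ℝ => Complex.exp (t * a) * Φ t) 0 t := by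
    intro t ht
    have h1 : HasDerivAt (fun t : ℝ => (t : ℂ) * a) (1 * a) t :=
      (Complex.ofRealCLM.hasDerivAt (x := t)).mul_const _
    exact (h1.cexp.mul (hΦd t ht)).congr_deriv (by ring)
  have hconst := constant_of_has_deriv_right_zero (a := 0) (b := δ)
    (fun t ht => (hχd t ht).continuousAt.continuousWithinAt)
    (fun t ht => (hχd t ⟨ht.1, ht.2.le⟩).hasDerivWithinAt) l hl
  rw [hΦ0, mul_zero, mul_eq_zero, or_iff_right (Complex.exp_ne_zero _)] at hconst
  refine integral_mul_eq_zero_of_linear_combination hF (memLp_exp_mul_I hψ l)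
    (memLp_exp_mul_I hu l) (1 + a) (-1) (fun y => ?_) hconst (h l hl)
  have := ek y
  linear_combination Complex.exp (l * (y * Complex.I)) * -this

theorem one_add_div_one_sub_eq (y : ℝ) : ((1 : ℂ) + y * Complex.I) / (1 - y * Complex.I) =
    2 * (1 - y * Complex.I)⁻¹ - 1 := by
  have := one_sub_mul_I_ne_zero y
  field_simp
  ring

/-- From `b = 2u - 1`, each factor `b` is traded for one more power of `u`, so `m` factors `b` use
up `m` of the `n` spare powers. -/
theorem integral_exp_blaschke_inv_pow_eq_zero (hF : MemLp F 2 volume) {n : ℕ} {l : ℝ}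
    (h : ∀ j ≤ n, ∫ y, F y * (Complex.exp (l * (y * Complex.I)) *
      ((1 : ℂ) - y * Complex.I)⁻¹ ^ (j + 1)) = 0) (m : ℕ) :
    ∀ j, m + j ≤ n → ∫ y, F y * (Complex.exp (l * (y * Complex.I)) *
      ((((1 : ℂ) + y * Complex.I) / (1 - y * Complex.I)) ^ m *
        ((1 : ℂ) - y * Complex.I)⁻¹ ^ (j + 1))) = 0 := by
  induction m with
  | zero =>
    intro j hj
    simpa using h j (by lia)
  | succ m ih =>
    intro j hj
    refine integral_mul_eq_zero_of_linear_combination hF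
      (memLp_exp_mul_I (memLp_one_add_div_one_sub_pow (memLp_inv_one_sub_pow (j + 1)) m) l)
      (memLp_exp_mul_I (memLp_one_add_div_one_sub_pow (memLp_inv_one_sub_pow j) m) l)
      2 (-1) (fun y => ?_) (ih (j + 1) (by lia)) (ih j (by lia))
    rw [pow_succ _ m]
    nth_rw 2 [one_add_div_one_sub_eq]
    ring

/-- Partial fractions give `b/(a+iy) = (2/(1+a) - 1)/(a+iy) + (2/(1+a)) u`. The remainder `b^m u` is
controlled for `m ≤ n`, which permits exactly `n + 1` factors `b`. -/
theorem integral_exp_blaschke_inv_add_eq_zero (hF : MemLp F 2 volume) {n : ℕ} {l : ℝ}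
    (h : ∀ j ≤ n, ∫ y, F y * (Complex.exp (l * (y * Complex.I)) *
      ((1 : ℂ) - y * Complex.I)⁻¹ ^ (j + 1)) = 0) {a : ℂ} (ha : 0 < a.re)
    (hFa : ∫ y, F y * (Complex.exp (l * (y * Complex.I)) * (a + y * Complex.I)⁻¹) = 0) :
    ∀ m ≤ n + 1, ∫ y, F y * (Complex.exp (l * (y * Complex.I)) *
      ((((1 : ℂ) + y * Complex.I) / (1 - y * Complex.I)) ^ m * (a + y * Complex.I)⁻¹)) = 0 := by
  intro m
  induction m with
  | zero =>
    intro _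
    simpa using hFa
  | succ m ih =>
    intro hm
    have ha1 : 1 + a ≠ 0 := add_ne_zero_of_re_pos (by simp) ha.le
    refine integral_mul_eq_zero_of_linear_combination hF
      (memLp_exp_mul_I (memLp_one_add_div_one_sub_pow (memLp_inv_add_mul_I ha) m) l)
      (memLp_exp_mul_I (memLp_one_add_div_one_sub_pow (memLp_inv_one_sub_pow 0) m) l)
      (2 / (1 + a) - 1) (2 / (1 + a)) (fun y => ?_) (ih (by lia))
      (integral_exp_blaschke_inv_pow_eq_zero hF h m 0 (by lia))
    rw [pow_succ _ m]
    nth_rw 2 [one_add_div_one_sub_eq]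
    have h1 := one_sub_mul_I_ne_zero y
    have h2 := add_mul_I_ne_zero ha y
    have e : ((1 : ℂ) - y * Complex.I)⁻¹ * (a + y * Complex.I)⁻¹ =
        (1 + a)⁻¹ * ((a + y * Complex.I)⁻¹ + (1 - y * Complex.I)⁻¹) := by
      field_simp
      ring
    simp only [zero_add, pow_one]
    linear_combination Complex.exp (l * (y * Complex.I)) *
      (((1 : ℂ) + y * Complex.I) / (1 - y * Complex.I)) ^ m * 2 * e

end Annihilator

theorem HasBoundary.exists_mul {f θ : ℂ → ℂ} {F : Lp ℂ 2 (volume : Measure ℝ)}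
    (hf : HasBoundary f F) {M : ℝ} (hd : DifferentiableOn ℂ θ rightHalfPlane)
    (hc : ContinuousOn θ {s | 0 ≤ s.re}) (hM : ∀ s : ℂ, 0 ≤ s.re → ‖θ s‖ ≤ M) :
    ∃ H : Lp ℂ 2 (volume : Measure ℝ), (H =ᵐ[volume] fun y => θ (y * Complex.I) * F y) ∧
      HasBoundary (fun s => θ s * f s) H := by
  have hm : MemLp (fun y : ℝ => θ (y * Complex.I) * F y) 2 volume :=
    memLp_mul_of_norm_le (Lp.memLp F) (hc.comp_continuous (by fun_prop) fun y => by simp)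
      fun y => hM _ (by simp)
  exact ⟨hm.toLp, hm.coeFn_toLp, hf.mul hd hc hM hm.coeFn_toLp⟩

theorem one_add_ne_zero {s : ℂ} (hs : 0 ≤ s.re) : 1 + s ≠ 0 := add_ne_zero_of_re_pos (by simp) hs

theorem norm_exp_neg_mul_le {t : ℝ} (ht : 0 ≤ t) {s : ℂ} (hs : 0 ≤ s.re) :
    ‖Complex.exp (-(t * s))‖ ≤ 1 := by
  rw [Complex.norm_exp, Real.exp_le_one_iff]
  simp
  positivity

theorem norm_inv_one_add_le {s : ℂ} (hs : 0 ≤ s.re) : ‖(1 + s)⁻¹‖ ≤ 1 := by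
  rw [norm_inv]
  refine inv_le_one_of_one_le₀ ?_
  have := Complex.re_le_norm (1 + s)
  simp at this
  linarith

theorem norm_one_sub_div_one_add_le {s : ℂ} (hs : 0 ≤ s.re) : ‖(1 - s) / (1 + s)‖ ≤ 1 := by
  rw [norm_div]
  refine div_le_one_of_le₀ ?_ (norm_nonneg _)
  rw [Complex.norm_def, Complex.norm_def]
  refine Real.sqrt_le_sqrt ?_
  simp [Complex.normSq_apply]
  nlinarith

/-! ### The generators `e^{-ls}/(1+s)^(n+1)` -/

section Kernel

variable {l : ℝ} (hl : 0 ≤ l) (n : ℕ)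

theorem differentiableOn_exp_mul_inv_pow :
    DifferentiableOn ℂ (fun s => Complex.exp (-(l * s)) * (1 + s)⁻¹ ^ n) rightHalfPlane := by
  refine DifferentiableOn.mul (by fun_prop) (DifferentiableOn.pow ?_ n)
  exact DifferentiableOn.inv (by fun_prop) fun s hs => one_add_ne_zero (le_of_lt hs)

theorem continuousOn_exp_mul_inv_pow :
    ContinuousOn (fun s : ℂ => Complex.exp (-(l * s)) * (1 + s)⁻¹ ^ n) {s | 0 ≤ s.re} := by
  refine ContinuousOn.mul (by fun_prop) (ContinuousOn.pow ?_ n)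
  exact ContinuousOn.inv₀ (by fun_prop) fun s hs => one_add_ne_zero hs

include hl in
theorem norm_exp_mul_inv_pow_le (s : ℂ) (hs : 0 ≤ s.re) :
    ‖Complex.exp (-(l * s)) * (1 + s)⁻¹ ^ n‖ ≤ 1 := by
  rw [norm_mul, norm_pow]
  exact mul_le_one₀ (norm_exp_neg_mul_le hl hs) (by positivity)
    (pow_le_one₀ (norm_nonneg _) (norm_inv_one_add_le hs))

include hl in
-- One factor `1/(1+s)` provides square integrability; the other `n` and the exponential form a
-- bounded multiplier.
theorem exists_hasBoundary_exp_mul_inv_pow :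
    ∃ G : Lp ℂ 2 (volume : Measure ℝ), (G =ᵐ[volume] fun y : ℝ =>
        Complex.exp (-(l * (y * Complex.I))) * (1 + y * Complex.I)⁻¹ ^ (n + 1)) ∧
      HasBoundary (fun s => 1 / (1 + s) ^ (n + 1) * Complex.exp (-(l * s))) G := by
  obtain ⟨G, hG, hb⟩ := (hasBoundary_inv_add (a := 1) (by simp)).exists_mul
    (differentiableOn_exp_mul_inv_pow n) (continuousOn_exp_mul_inv_pow n)
    (norm_exp_mul_inv_pow_le hl n)
  refine ⟨G, ?_, ?_⟩
  · filter_upwards [hG, (memLp_inv_add_mul_I (a := 1) (by simp)).coeFn_toLp] with y hy hy'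
    rw [hy, hy', pow_succ, mul_assoc]
  · convert hb using 1
    ext s
    rw [one_div, ← inv_pow, pow_succ]
    ring

end Kernel

/-! ### The inner function and the two inclusions -/

section InnerFunction

variable (n : ℕ) {δ : ℝ} (hδ : 0 ≤ δ)

theorem differentiableOn_blaschke_pow_mul_exp :
    DifferentiableOn ℂ (fun s => ((1 - s) / (1 + s)) ^ (n + 1) * Complex.exp (-(δ * s)))
      rightHalfPlane := by
  refine DifferentiableOn.mul (DifferentiableOn.pow ?_ _) (by fun_prop)
  exact DifferentiableOn.div (by fun_prop) (by fun_prop) fun s hs => one_add_ne_zero (le_of_lt hs)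

theorem continuousOn_blaschke_pow_mul_exp :
    ContinuousOn (fun s : ℂ => ((1 - s) / (1 + s)) ^ (n + 1) * Complex.exp (-(δ * s)))
      {s | 0 ≤ s.re} := by
  refine ContinuousOn.mul (ContinuousOn.pow ?_ _) (by fun_prop)
  exact ContinuousOn.div (by fun_prop) (by fun_prop) fun s hs => one_add_ne_zero hs

include hδ in
theorem norm_blaschke_pow_mul_exp_le (s : ℂ) (hs : 0 ≤ s.re) :
    ‖((1 - s) / (1 + s)) ^ (n + 1) * Complex.exp (-(δ * s))‖ ≤ 1 := by
  rw [norm_mul, norm_pow]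
  exact mul_le_one₀ (pow_le_one₀ (norm_nonneg _) (norm_one_sub_div_one_add_le hs))
    (norm_nonneg _) (norm_exp_neg_mul_le hδ hs)

include hδ in
theorem isInner_blaschke_pow_mul_exp :
    IsInner (fun s => ((1 - s) / (1 + s)) ^ (n + 1) * Complex.exp (-(δ * s))) where
  differentiableOn := differentiableOn_blaschke_pow_mul_exp n
  norm_le_one s hs := norm_blaschke_pow_mul_exp_le n hδ s (le_of_lt hs)
  boundary := by
    refine Eventually.of_forall fun y => ?_
    have h1 : ‖((1 - y * Complex.I) / (1 + y * Complex.I)) ^ (n + 1) *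
        Complex.exp (-(δ * (y * Complex.I)))‖ = 1 := by
      rw [norm_mul, norm_exp_boundary, mul_one, norm_pow, ← inv_div, norm_inv,
        norm_one_add_div_one_sub]
      simp
    rw [← h1]
    have hc := (continuousOn_blaschke_pow_mul_exp n (δ := δ) (y * Complex.I) (by simp)).norm
    refine Tendsto.comp (f := fun x : ℝ => (x : ℂ) + y * Complex.I) hc.tendsto ?_
    refine tendsto_nhdsWithin_iff.mpr ⟨?_, ?_⟩
    · have : Continuous fun x : ℝ => (x : ℂ) + y * Complex.I := by fun_prop
      exact (this.tendsto' 0 _ (by simp)).mono_left nhdsWithin_le_nhds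
    · filter_upwards [self_mem_nhdsWithin] with x hx
      have hx' : 0 < x := hx
      simpa using hx'.le

include hδ in
theorem cyclicSubspace_le_modelSpace :
    cyclicSubspace δ (fun s => 1 / (1 + s) ^ (n + 1)) ≤
      modelSpace (fun s => ((1 - s) / (1 + s)) ^ (n + 1) * Complex.exp (-(δ * s))) := by
  refine Submodule.topologicalClosure_minimal _ ?_ (Submodule.isClosed_orthogonal _)
  refine Submodule.isOrtho_span.mpr ?_
  rintro ⟨G, hG2⟩ ⟨l, hl, hG⟩ ⟨F, hF2⟩ ⟨h, ⟨H, hH2⟩, hH, hF⟩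
  change inner ℂ G F = 0
  obtain ⟨G', hG', hGb⟩ := exists_hasBoundary_exp_mul_inv_pow hl.1 n
  obtain rfl := hG.unique hGb
  obtain ⟨F', hF', hFb⟩ := hH.exists_mul (differentiableOn_blaschke_pow_mul_exp n)
    (continuousOn_blaschke_pow_mul_exp n) (norm_blaschke_pow_mul_exp_le n hδ)
  obtain rfl := hF.unique hFb
  -- Of the `n + 1` factors `1/(1+iy)` in conjugate generator times `θ`, `n` join `e^{-(δ-l)s}` as a
  -- multiplier, bounded because `l ≤ δ`; the last is the Cauchy kernel with `a = 1`.
  obtain ⟨P, hP, hPb⟩ := hH.exists_mul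
    (differentiableOn_exp_mul_inv_pow (l := δ - l) n)
    (continuousOn_exp_mul_inv_pow n) (norm_exp_mul_inv_pow_le (sub_nonneg.mpr hl.2) n)
  rw [inner_eq_integral, ← hPb.integral_mul_inv_eq_zero (a := 1) (by simp)]
  refine integral_congr_ae ?_
  filter_upwards [hG', hF', hP] with y h1 h2 h3
  rw [h1, h2, h3, map_mul, map_pow, map_inv₀, conj_one_add_mul_I, ← Complex.exp_conj]
  have e1 : conj (-((l : ℂ) * (y * Complex.I))) = l * (y * Complex.I) := by simp
  have e2 : Complex.exp (-(((δ - l : ℝ) : ℂ) * (y * Complex.I))) =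
      Complex.exp (-(δ * (y * Complex.I))) * Complex.exp (l * (y * Complex.I)) := by
    rw [← Complex.exp_add]; push_cast; ring_nf
  have h4 := one_sub_mul_I_ne_zero y
  have h5 := one_add_ne_zero (s := y * Complex.I) (by simp)
  have e3 : ((1 - y * Complex.I) / (1 + y * Complex.I)) ^ (n + 1) *
      (1 - y * Complex.I)⁻¹ ^ (n + 1) = (1 + (y : ℂ) * Complex.I)⁻¹ ^ n *
      (1 + y * Complex.I)⁻¹ := by
    rw [← mul_pow, ← pow_succ]
    congr 1
    field_simp
  rw [e1, e2]
  linear_combination Complex.exp (-(δ * (y * Complex.I))) * Complex.exp (l * (y * Complex.I)) *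
    H y * e3

theorem modelSpace_le_cyclicSubspace (hδ : 0 < δ) :
    modelSpace (fun s => ((1 - s) / (1 + s)) ^ (n + 1) * Complex.exp (-(δ * s))) ≤
      cyclicSubspace δ (fun s => 1 / (1 + s) ^ (n + 1)) := by
  rw [cyclicSubspace, ← Submodule.orthogonal_orthogonal_eq_closure]
  refine Submodule.orthogonal_le ?_
  rintro ⟨F, hF2⟩ hF
  obtain ⟨f, hf⟩ := hF2
  have hFL := Lp.memLp F
  have hann : ∀ l ∈ Icc (0 : ℝ) δ, ∫ y, F y * (Complex.exp (l * (y * Complex.I)) *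
      ((1 : ℂ) - y * Complex.I)⁻¹ ^ (n + 1)) = 0 := by
    intro l hl
    obtain ⟨G, hG, hGb⟩ := exists_hasBoundary_exp_mul_inv_pow hl.1 n
    have h1 : inner ℂ G F = 0 := hF ⟨G, _, hGb⟩ (Submodule.subset_span ⟨l, hl, hGb⟩)
    rw [← h1, inner_eq_integral]
    refine integral_congr_ae ?_
    filter_upwards [hG] with y hy
    rw [hy, map_mul, map_pow, map_inv₀, conj_one_add_mul_I, ← Complex.exp_conj]
    simp
  have hpow := integral_exp_inv_pow_eq_zero hFL hδ n hann
  have hδm : δ ∈ Icc 0 δ := ⟨hδ.le, le_rfl⟩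
  -- The quotient `F/θ = conj θ · F` on the axis.
  have hm := memLp_exp_mul_I (memLp_one_add_div_one_sub_pow hFL (n + 1)) δ
  have hH : hm.toLp ∈ H2 := by
    refine mem_H2_of_integral_mul_inv_eq_zero _ fun a ha => ?_
    have h1 := integral_exp_inv_add_eq_zero hFL ha (hf.integral_mul_inv_eq_zero ha)
      (fun l hl => by simpa using hpow 0 (Nat.zero_le n) l hl) hδm
    rw [← integral_exp_blaschke_inv_add_eq_zero hFL (fun j hj => hpow j hj δ hδm) ha h1 (n + 1)
      le_rfl]
    refine integral_congr_ae ?_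
    filter_upwards [hm.coeFn_toLp] with y hy
    rw [hy]
    ring
  obtain ⟨h, hh⟩ := hH
  -- `F` is itself of the form `θh`, so no closure of the span is needed.
  refine Submodule.subset_span ⟨h, ⟨_, h, hh⟩, hh, ?_⟩
  refine hh.mul (differentiableOn_blaschke_pow_mul_exp n) (continuousOn_blaschke_pow_mul_exp n)
    (norm_blaschke_pow_mul_exp_le n hδ.le) ?_
  filter_upwards [hm.coeFn_toLp] with y hy
  rw [hy]
  have h4 := one_sub_mul_I_ne_zero y
  have h5 := one_add_ne_zero (s := y * Complex.I) (by simp)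
  have e1 : ((1 - y * Complex.I) / (1 + y * Complex.I)) ^ (n + 1) *
      (((1 : ℂ) + y * Complex.I) / (1 - y * Complex.I)) ^ (n + 1) = 1 := by
    rw [← mul_pow, div_mul_div_comm, mul_comm, div_self (mul_ne_zero h5 h4), one_pow]
  have e2 : Complex.exp (-(δ * (y * Complex.I))) * Complex.exp (δ * (y * Complex.I)) = 1 := by
    rw [← Complex.exp_add, neg_add_cancel, Complex.exp_zero]
  linear_combination -F y * e2 - F y * Complex.exp (-(δ * (y * Complex.I))) *
    Complex.exp (δ * (y * Complex.I)) * e1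

end InnerFunction

/-! ### Backward shift invariance and conclusion -/

/-- Multiplication by `e^{-ts}` commutes with multiplication by `θ`, so it preserves the span of the
products `θh`; its adjoint then preserves the orthogonal complement. No property of `θ` enters. -/
theorem isBackwardShiftInvariant_modelSpace (θ : ℂ → ℂ) :
    IsBackwardShiftInvariant (modelSpace θ) := by
  intro t F hF
  refine (Submodule.mem_orthogonal _ _).mpr fun u hu => ?_
  rw [ContinuousLinearMap.adjoint_inner_right]
  refine hF _ ?_
  refine (Submodule.span_le.mpr ?_ :
    _ ≤ (Submodule.span ℂ _).comap (multSemigroup t).toLinearMap) hu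
  rintro G ⟨h, H, hH, hG⟩
  refine Submodule.subset_span ⟨_, multSemigroup t H, hH.exp_mul t.2, ?_⟩
  have := hG.exp_mul t.2
  simp only [mul_left_comm _ (θ _)] at this
  exact this

end HardyRHP

theorem mainTheorem11 (n : ℕ) (δ : ℝ) (hδ : 0 < δ) :
    HardyRHP.IsBackwardShiftInvariant
        (HardyRHP.cyclicSubspace δ (fun s => 1 / (1 + s) ^ (n + 1))) ∧
      HardyRHP.IsInner (fun s => ((1 - s) / (1 + s)) ^ (n + 1) * Complex.exp (-(δ * s))) ∧
      HardyRHP.cyclicSubspace δ (fun s => 1 / (1 + s) ^ (n + 1)) =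
        HardyRHP.modelSpace
          (fun s => ((1 - s) / (1 + s)) ^ (n + 1) * Complex.exp (-(δ * s))) := by
  have h := le_antisymm (HardyRHP.cyclicSubspace_le_modelSpace n hδ.le)
    (HardyRHP.modelSpace_le_cyclicSubspace n hδ)
  refine ⟨?_, HardyRHP.isInner_blaschke_pow_mul_exp n hδ.le, h⟩
  rw [h]
  exact HardyRHP.isBackwardShiftInvariant_modelSpace _
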